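/- **Conventions.** Associators and unitors are not written. Composition is written $g.f$ ("$f$ first"). An object also denotes its identity morphism. A *duoidal category* is a category $\mathcal M$ with two monoidal structures $(\circ,I)$ and $(\bullet,J)$, with morphisms $\delta:I\to I\bullet I$, $\varpi:J\circ J\to J$, $\tau:I\to J$ and a natural transformation $$\zeta_{A,B,C,D}:(A\bullet B)\circ(C\bullet D)\to(A\circ C)\bullet(B\circ D),$$ such that $(J,\varpi,\tau)$ is a monoid in $(\mathcal M,\circ)$, $(I,\delta,\tau)$ is a comonoid in $(\mathcal M,\bullet)$, the two composites built from $\zeta$ $$(A\bullet B)\circ(C\bullet D)\circ(E\bullet F)\rightrightarrows(A\circ C\circ E)\bullet(B\circ D\circ F),$$ $$(A\bullet B\bullet C)\circ(D\bullet E\bullet F)\rightrightarrows(A\circ D)\bullet(B\circ E)\bullet(C\circ F)$$ coincide in each line, and $$\zeta_{I,I,A,B}.(\delta\circ(A\bullet B)),\qquad \zeta_{A,B,I,I}.((A\bullet B)\circ\delta),\qquad (\varpi\bullet(A\circ B)).\zeta_{J,A,J,B},\qquad ((A\circ B)\bullet\varpi).\zeta_{A,J,B,J}$$ are identities (up to unitors).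 A *weak bimonad* on a monoidal category $(\mathcal C,\otimes,K)$ is a monad $(T,\mu,\eta)$ on $\mathcal C$ together with a monoidal structure on its Eilenberg–Moore category $\mathcal C^T$ and a separable Frobenius monoidal structure on the forgetful functor $U:\mathcal C^T\to\mathcal C$. The latter means a monoidal structure $(U_2:UX\otimes UY\to U(X\otimes Y),\ U_0:K\to U\mathbf 1)$, where $\mathbf 1$ denotes the monoidal unit of $\mathcal C^T$, and an opmonoidal structure $(U^2,U^0)$ (in the opposite directions), satisfying $$U_2.U^2=\mathrm{id},\qquad (UX\otimes U_2).(U^2\otimes UZ)=U^2.U_2,\qquad (U_2\otimes UZ).(UX\otimes U^2)=U^2.U_2 .$$ It induces morphisms $T_2:T(X\otimes Y)\to TX\otimes TY$ and $T_0:TK\to K$. These are $U^2$ and $U^0$ composed after the $T$-algebra morphisms (out of the free algebras) that correspond under the free–forgetful adjunction to $U_2.(\eta_X\otimes\eta_Y):X\otimes Y\to U(FX\otimes FY)$ and to $U_0:K\to U\mathbf 1$, where $F$ is the free algebra functor. A *weak bicomonad* $G$ on $\mathcal C$ is a weak bimonad on $\mathcal C^{\mathrm{op}}$; it induces morphisms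 $G_2:GX\otimes GY\to G(X\otimes Y)$ and $G_0:K\to GK$. **Axioms.** Let $A$ be an object of a duoidal category with a monoid structure $(\mu:A\circ A\to A,\ \eta:I\to A)$ in $(\mathcal M,\circ)$ and a comonoid structure $(\Delta:A\to A\bullet A,\ \varepsilon:A\to J)$ in $(\mathcal M,\bullet)$. Consider * $(\mathsf{WB})$: $\Delta.\mu=(\mu\bullet\mu).\zeta_{A,A,A,A}.(\Delta\circ\Delta)$. Write $u=\Delta.\eta:I\to A\bullet A$ and $c=\varepsilon.\mu:A\circ A\to J$. The morphism $(I\bullet A\bullet\Delta).(I\bullet\Delta).(I\bullet\eta).\delta:I\to I\bullet A\bullet A\bullet A$ is equal to * $(\mathsf{RRU})$: $(I\bullet A\bullet\mu\bullet A).(\zeta_{I,A,I\bullet A,A}\bullet A).(((I\bullet A)\circ(I\bullet u))\bullet A).(((I\bullet A)\circ\delta)\bullet A).(I\bullet u).\delta$; * $(\mathsf{RLU})$: $(I\bullet A\bullet\mu\bullet A).(\zeta_{I\bullet A,A,I,A}\bullet A).(((I\bullet u)\circ(I\bullet A))\bullet A).((\delta\circ(I\bullet A))\bullet A).(I\bullet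 u).\delta$. The morphism $(\Delta\bullet A\bullet I).(\Delta\bullet I).(\eta\bullet I).\delta:I\to A\bullet A\bullet A\bullet I$ is equal to * $(\mathsf{LRU})$: $(A\bullet\mu\bullet A\bullet I).(A\bullet\zeta_{A,I,A,A\bullet I}).(A\bullet((A\bullet I)\circ(u\bullet I))).(A\bullet((A\bullet I)\circ\delta)).(u\bullet I).\delta$; * $(\mathsf{LLU})$: $(A\bullet\mu\bullet A\bullet I).(A\bullet\zeta_{A,A\bullet I,A,I}).(A\bullet((u\bullet I)\circ(A\bullet I))).(A\bullet(\delta\circ(A\bullet I))).(u\bullet I).\delta$. The morphism $\varpi.(J\circ\varepsilon).(J\circ\mu).(J\circ A\circ\mu):J\circ A\circ A\circ A\to J$ is equal to * $(\mathsf{LRC})$: $\varpi.(J\circ c).((\varpi\bullet(J\circ A))\circ A).(((J\circ c)\bullet(J\circ A))\circ A).(\zeta_{J\circ A,J,A,A}\circ A).(J\circ A\circ\Delta\circ A)$; * $(\mathsf{LLC})$: $\varpi.(J\circ c).(((J\circ A)\bullet\varpi)\circ A).(((J\circ A)\bullet(J\circ c))\circ A).(\zeta_{J,J\circ A,A,A}\circ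 A).(J\circ A\circ\Delta\circ A)$. The morphism $\varpi.(\varepsilon\circ J).(\mu\circ J).(\mu\circ A\circ J):A\circ A\circ A\circ J\to J$ is equal to * $(\mathsf{RRC})$: $\varpi.(c\circ J).(A\circ(\varpi\bullet(A\circ J))).(A\circ((c\circ J)\bullet(A\circ J))).(A\circ\zeta_{A,A,A\circ J,J}).(A\circ\Delta\circ A\circ J)$; * $(\mathsf{RLC})$: $\varpi.(c\circ J).(A\circ((A\circ J)\bullet\varpi)).(A\circ((A\circ J)\bullet(c\circ J))).(A\circ\zeta_{A,A,J,A\circ J}).(A\circ\Delta\circ A\circ J)$. **Statement.** Let $\mathcal M$ be a duoidal category in which idempotent morphisms split, and let $A$ be an object with a monoid structure for $\circ$ and a comonoid structure for $\bullet$ satisfying $(\mathsf{WB})$. 1. If $(\mathsf{RLU})$, $(\mathsf{LLU})$, $(\mathsf{RLC})$ and $(\mathsf{RRC})$ hold, then the monad $T=A\circ(-)$ induced by the monoid $A$ is a weak bimonad on $(\mathcal M,\bullet)$, with $T_2=\zeta_{A,A,X,Y}.(\Delta\circ(X\bullet Y)):A\circ(X\bullet Y)\to(A\circ X)\bullet(A\circ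 Y)$ and $T_0=\varpi.(\varepsilon\circ J):A\circ J\to J$. 2. If $(\mathsf{LLC})$, $(\mathsf{RLC})$, $(\mathsf{RRU})$ and $(\mathsf{RLU})$ hold, then the comonad $G=(-)\bullet A$ induced by the comonoid $A$ is a weak bicomonad on $(\mathcal M,\circ)$, with $G_2=((X\circ Y)\bullet\mu).\zeta_{X,A,Y,A}:(X\bullet A)\circ(Y\bullet A)\to(X\circ Y)\bullet A$ and $G_0=(I\bullet\eta).\delta:I\to I\bullet A$. 3. If $(\mathsf{LRC})$, $(\mathsf{RRC})$, $(\mathsf{LRU})$ and $(\mathsf{LLU})$ hold, then the comonad $G=A\bullet(-)$ induced by the comonoid $A$ is a weak bicomonad on $(\mathcal M,\circ)$, with $G_2=(\mu\bullet(X\circ Y)).\zeta_{A,X,A,Y}:(A\bullet X)\circ(A\bullet Y)\to A\bullet(X\circ Y)$ and $G_0=(\eta\bullet I).\delta:I\to A\bullet I$. -/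

import Mathlib

open CategoryTheory MonoidalCategory Opposite

universe v u

section WeakBimonads

/-- A weak bimonad structure on a monad `T` on a monoidal category `C`: a monoidal structure on the
Eilenberg--Moore category of `T`, together with a separable Frobenius monoidal structure (a monoidal
and an opmonoidal structure subject to the two Frobenius conditions and the separability condition)
on the forgetful functor to `C`. -/
structure WeakBimonad {C : Type u} [Category.{v} C] [MonoidalCategory C] (T : Monad C) where
  monoidal : MonoidalCategory T.Algebra
  lax : T.forget.LaxMonoidal
  oplax : T.forget.OplaxMonoidal
  frobenius_left : ∀ X Y Z : T.Algebra,
    oplax.δ X Y ▷ Z.A ≫ (α_ X.A Y.A Z.A).hom ≫ X.A ◁ lax.μ Y Z =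
      lax.μ (X ⊗ Y) Z ≫ T.forget.map (α_ X Y Z).hom ≫ oplax.δ X (Y ⊗ Z)
  frobenius_right : ∀ X Y Z : T.Algebra,
    X.A ◁ oplax.δ Y Z ≫ (α_ X.A Y.A Z.A).inv ≫ lax.μ X Y ▷ Z.A =
      lax.μ X (Y ⊗ Z) ≫ T.forget.map (α_ X Y Z).inv ≫ oplax.δ (X ⊗ Y) Z
  separable : ∀ X Y : T.Algebra, oplax.δ X Y ≫ lax.μ X Y = 𝟙 ((X ⊗ Y).A)

namespace WeakBimonad

variable {C : Type u} [Category.{v} C] [MonoidalCategory C] {T : Monad C}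

/-- The binary part `T₂ : T(X ⊗ Y) ⟶ TX ⊗ TY` of the induced opmonoidal structure on `T`: the
opmonoidal structure of the forgetful functor after (the forgetful image of) the adjunct of
`X ⊗ Y ⟶ TX ⊗ TY ⟶ U(FX ⊗ FY)`, where `FX`, `FY` are the free algebras. -/
def comul (W : WeakBimonad T) (X Y : C) : T.obj (X ⊗ Y) ⟶ T.obj X ⊗ T.obj Y :=
  letI := W.monoidal
  T.map ((T.η.app X ⊗ₘ T.η.app Y) ≫ W.lax.μ (T.free.obj X) (T.free.obj Y)) ≫
    (T.free.obj X ⊗ T.free.obj Y).a ≫ W.oplax.δ (T.free.obj X) (T.free.obj Y)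

/-- The nullary part `T₀ : TK ⟶ K` of the induced opmonoidal structure on `T`: the nullary
opmonoidal structure of the forgetful functor after the adjunct of its monoidal one. -/
def counit (W : WeakBimonad T) : T.obj (𝟙_ C) ⟶ 𝟙_ C :=
  letI := W.monoidal
  T.map W.lax.ε ≫ (𝟙_ T.Algebra).a ≫ W.oplax.η

end WeakBimonad

/-- A comonad on `C`, seen as a monad on the opposite category. -/
def comonadOp {C : Type u} [Category.{v} C] (G : Comonad C) : Monad Cᵒᵖ where
  toFunctor := G.toFunctor.op
  η := { app := fun X => (G.ε.app X.unop).op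
         naturality := fun _ _ f => Quiver.Hom.unop_inj (G.ε.naturality f.unop).symm }
  μ := { app := fun X => (G.δ.app X.unop).op
         naturality := fun _ _ f => Quiver.Hom.unop_inj (G.δ.naturality f.unop).symm }
  assoc X := Quiver.Hom.unop_inj (G.coassoc X.unop)
  left_unit X := Quiver.Hom.unop_inj (G.left_counit X.unop)
  right_unit X := Quiver.Hom.unop_inj (G.right_counit X.unop)

/-- A weak bicomonad is a weak bimonad on the opposite category. -/
abbrev WeakBicomonad {C : Type u} [Category.{v} C] [MonoidalCategory C] (G : Comonad C) :=
  WeakBimonad (comonadOp G)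

namespace WeakBicomonad

variable {C : Type u} [Category.{v} C] [MonoidalCategory C] {G : Comonad C}

/-- The binary part `GX ⊗ GY ⟶ G(X ⊗ Y)` of the induced monoidal structure on `G`. -/
def mul (W : WeakBicomonad G) (X Y : C) : G.obj X ⊗ G.obj Y ⟶ G.obj (X ⊗ Y) :=
  (WeakBimonad.comul W (op X) (op Y)).unop

/-- The nullary part `K ⟶ GK` of the induced monoidal structure on `G`. -/
def unit (W : WeakBicomonad G) : 𝟙_ C ⟶ G.obj (𝟙_ C) :=
  (WeakBimonad.counit W).unop

end WeakBicomonad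

/-- The monad `A ⊗ (-)` of a monoid `A`. -/
def leftMonad {C : Type u} [Category.{v} C] [MonoidalCategory C] (A : C) [MonObj A] : Monad C where
  toFunctor := tensorLeft A
  η := { app := fun X => (λ_ X).inv ≫ MonObj.one (X := A) ▷ X
         naturality := fun X Y f => by simp [← whisker_exchange] }
  μ := { app := fun X => (α_ A A X).inv ≫ MonObj.mul (X := A) ▷ X
         naturality := fun X Y f => by simp [← whisker_exchange] }
  assoc X := by
    have h := congrArg (fun t => t ▷ X) (MonObj.mul_assoc A)
    simp only [comp_whiskerRight, whisker_assoc, Category.assoc] at h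
    simp [h]
  left_unit X := by
    have h := congrArg (fun t => t ▷ X) (MonObj.one_mul A)
    simp only [comp_whiskerRight] at h
    simp [h]
  right_unit X := by
    have h := congrArg (fun t => t ▷ X) (MonObj.mul_one A)
    simp only [comp_whiskerRight, whisker_assoc, Category.assoc] at h
    rw [← Iso.eq_inv_comp] at h
    simp [h]

/-- The comonad `A ⊗ (-)` of a comonoid `A`. -/
def leftComonad {C : Type u} [Category.{v} C] [MonoidalCategory C] (A : C) [ComonObj A] :
    Comonad C where
  toFunctor := tensorLeft A
  ε := { app := fun X => ComonObj.counit (X := A) ▷ X ≫ (λ_ X).hom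
         naturality := fun X Y f => by simp [whisker_exchange_assoc] }
  δ := { app := fun X => ComonObj.comul (X := A) ▷ X ≫ (α_ A A X).hom
         naturality := fun X Y f => by simp [whisker_exchange_assoc] }
  coassoc X := by
    have h := congrArg (fun t => t ▷ X ≫ (α_ A (A ⊗ A) X).hom ≫ A ◁ (α_ A A X).hom)
      (ComonObj.comul_assoc A)
    simpa [-ComonObj.comul_assoc, -ComonObj.counit_comul, -ComonObj.comul_counit] using h
  left_counit X := by
    have h := congrArg (fun t => t ▷ X ≫ (λ_ A).hom ▷ X) (ComonObj.counit_comul A)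
    simpa [-ComonObj.comul_assoc, -ComonObj.counit_comul, -ComonObj.comul_counit] using h
  right_counit X := by
    have h := congrArg (fun t => t ▷ X ≫ (ρ_ A).hom ▷ X) (ComonObj.comul_counit A)
    simpa [-ComonObj.comul_assoc, -ComonObj.counit_comul, -ComonObj.comul_counit] using h

/-- The comonad `(-) ⊗ A` of a comonoid `A`. -/
def rightComonad {C : Type u} [Category.{v} C] [MonoidalCategory C] (A : C) [ComonObj A] :
    Comonad C where
  toFunctor := tensorRight A
  ε := { app := fun X => X ◁ ComonObj.counit (X := A) ≫ (ρ_ X).hom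
         naturality := fun X Y f => by simp [← whisker_exchange_assoc] }
  δ := { app := fun X => X ◁ ComonObj.comul (X := A) ≫ (α_ X A A).inv
         naturality := fun X Y f => by simp [← whisker_exchange_assoc] }
  coassoc X := by
    have h := congrArg (fun t => X ◁ t ≫ X ◁ (α_ A A A).inv ≫ (α_ X (A ⊗ A) A).inv ≫
      (α_ X A A).inv ▷ A) (ComonObj.comul_assoc A)
    simpa [-ComonObj.comul_assoc, -ComonObj.counit_comul, -ComonObj.comul_counit] using h.symm
  left_counit X := by
    have h := congrArg (fun t => X ◁ t ≫ X ◁ (ρ_ A).hom) (ComonObj.comul_counit A)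
    simpa [-ComonObj.comul_assoc, -ComonObj.counit_comul, -ComonObj.comul_counit] using h
  right_counit X := by
    have h := congrArg (fun t => X ◁ t ≫ X ◁ (λ_ A).hom) (ComonObj.counit_comul A)
    simpa [-ComonObj.comul_assoc, -ComonObj.counit_comul, -ComonObj.comul_counit] using h

end WeakBimonads

section Duoidal

/-- Two monoidal structures on one category: the first with product `⊚` and unit `𝕀`, the second
with product `⊡` and unit `𝕁`. -/
class TwoMonoidal (C : Type u) [Category.{v} C] where
  circ : MonoidalCategory C
  bul : MonoidalCategory C

namespace TwoMonoidal

variable {C : Type u} [Category.{v} C] [TwoMonoidal C]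

abbrev circObj (X Y : C) : C := (circ (C := C)).tensorObj X Y
abbrev bulObj (X Y : C) : C := (bul (C := C)).tensorObj X Y
abbrev circUnit : C := (circ (C := C)).tensorUnit
abbrev bulUnit : C := (bul (C := C)).tensorUnit

infixl:70 " ⊚ " => circObj
infixl:70 " ⊡ " => bulObj
notation "𝕀" => circUnit
notation "𝕁" => bulUnit

abbrev circHom {X X' Y Y' : C} (f : X ⟶ X') (g : Y ⟶ Y') : X ⊚ Y ⟶ X' ⊚ Y' :=
  (circ (C := C)).tensorHom f g
abbrev bulHom {X X' Y Y' : C} (f : X ⟶ X') (g : Y ⟶ Y') : X ⊡ Y ⟶ X' ⊡ Y' :=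
  (bul (C := C)).tensorHom f g

infixl:81 " ⊚ₘ " => circHom
infixl:81 " ⊡ₘ " => bulHom

/-- Associators and unitors of the first monoidal structure. -/
abbrev cα (X Y Z : C) : (X ⊚ Y) ⊚ Z ≅ X ⊚ (Y ⊚ Z) := (circ (C := C)).associator X Y Z
abbrev cl (X : C) : 𝕀 ⊚ X ≅ X := (circ (C := C)).leftUnitor X
abbrev cr (X : C) : X ⊚ 𝕀 ≅ X := (circ (C := C)).rightUnitor X

/-- Associators and unitors of the second monoidal structure. -/
abbrev bα (X Y Z : C) : (X ⊡ Y) ⊡ Z ≅ X ⊡ (Y ⊡ Z) := (bul (C := C)).associator X Y Z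
abbrev bl (X : C) : 𝕁 ⊡ X ≅ X := (bul (C := C)).leftUnitor X
abbrev br (X : C) : X ⊡ 𝕁 ≅ X := (bul (C := C)).rightUnitor X

end TwoMonoidal

open TwoMonoidal

/-- A duoidal category. -/
class Duoidal (C : Type u) [Category.{v} C] extends TwoMonoidal C where
  /-- the morphisms `δ`, `ϖ`, `τ` between the units, and the interchange law `ζ` -/
  δ : (𝕀 : C) ⟶ 𝕀 ⊡ 𝕀
  ϖ : (𝕁 : C) ⊚ 𝕁 ⟶ 𝕁
  τ : (𝕀 : C) ⟶ 𝕁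
  ζ : ∀ X Y Z W : C, (X ⊡ Y) ⊚ (Z ⊡ W) ⟶ (X ⊚ Z) ⊡ (Y ⊚ W)
  ζ_natural : ∀ {X X' Y Y' Z Z' W W' : C} (f : X ⟶ X') (g : Y ⟶ Y') (h : Z ⟶ Z') (k : W ⟶ W'),
    ((f ⊡ₘ g) ⊚ₘ (h ⊡ₘ k)) ≫ ζ X' Y' Z' W' = ζ X Y Z W ≫ ((f ⊚ₘ h) ⊡ₘ (g ⊚ₘ k))
  /-- `(𝕁, ϖ, τ)` is a monoid for `⊚` -/
  ϖ_assoc : (ϖ ⊚ₘ 𝟙 𝕁) ≫ ϖ = (cα 𝕁 𝕁 𝕁).hom ≫ (𝟙 𝕁 ⊚ₘ ϖ) ≫ ϖ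
  τ_ϖ : (τ ⊚ₘ 𝟙 𝕁) ≫ ϖ = (cl 𝕁).hom
  ϖ_τ : (𝟙 𝕁 ⊚ₘ τ) ≫ ϖ = (cr 𝕁).hom
  /-- `(𝕀, δ, τ)` is a comonoid for `⊡` -/
  δ_coassoc : δ ≫ (δ ⊡ₘ 𝟙 𝕀) ≫ (bα 𝕀 𝕀 𝕀).hom = δ ≫ (𝟙 𝕀 ⊡ₘ δ)
  δ_τ_left : δ ≫ (τ ⊡ₘ 𝟙 𝕀) = (bl 𝕀).inv
  δ_τ_right : δ ≫ (𝟙 𝕀 ⊡ₘ τ) = (br 𝕀).inv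
  /-- associativity -/
  ζ_circ_assoc : ∀ X Y Z W U V : C,
    (ζ X Y Z W ⊚ₘ 𝟙 (U ⊡ V)) ≫ ζ (X ⊚ Z) (Y ⊚ W) U V ≫ ((cα X Z U).hom ⊡ₘ (cα Y W V).hom) =
      (cα (X ⊡ Y) (Z ⊡ W) (U ⊡ V)).hom ≫ (𝟙 (X ⊡ Y) ⊚ₘ ζ Z W U V) ≫ ζ X Y (Z ⊚ U) (W ⊚ V)
  ζ_bul_assoc : ∀ X Y Z W U V : C,
    ζ (X ⊡ Y) Z (W ⊡ U) V ≫ (ζ X Y W U ⊡ₘ 𝟙 (Z ⊚ V)) ≫ (bα (X ⊚ W) (Y ⊚ U) (Z ⊚ V)).hom =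
      ((bα X Y Z).hom ⊚ₘ (bα W U V).hom) ≫ ζ X (Y ⊡ Z) W (U ⊡ V) ≫ (𝟙 (X ⊚ W) ⊡ₘ ζ Y Z U V)
  /-- unitality -/
  ζ_δ_left : ∀ X Y : C,
    (δ ⊚ₘ 𝟙 (X ⊡ Y)) ≫ ζ 𝕀 𝕀 X Y ≫ ((cl X).hom ⊡ₘ (cl Y).hom) = (cl (X ⊡ Y)).hom
  ζ_δ_right : ∀ X Y : C,
    (𝟙 (X ⊡ Y) ⊚ₘ δ) ≫ ζ X Y 𝕀 𝕀 ≫ ((cr X).hom ⊡ₘ (cr Y).hom) = (cr (X ⊡ Y)).hom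
  ζ_ϖ_left : ∀ X Y : C,
    ((bl X).inv ⊚ₘ (bl Y).inv) ≫ ζ 𝕁 X 𝕁 Y ≫ (ϖ ⊡ₘ 𝟙 (X ⊚ Y)) = (bl (X ⊚ Y)).inv
  ζ_ϖ_right : ∀ X Y : C,
    ((br X).inv ⊚ₘ (br Y).inv) ≫ ζ X 𝕁 Y 𝕁 ≫ (𝟙 (X ⊚ Y) ⊡ₘ ϖ) = (br (X ⊚ Y)).inv

open Duoidal

/-- A monoid structure for `⊚` together with a comonoid structure for `⊡` on one object. -/
structure MonoidComonoid {C : Type u} [Category.{v} C] [Duoidal C] (A : C) where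
  mon : @MonObj C _ circ A
  comon : @ComonObj C _ bul A

namespace MonoidComonoid

variable {C : Type u} [Category.{v} C] [Duoidal C] {A : C} (S : MonoidComonoid A)

abbrev μ : A ⊚ A ⟶ A := S.mon.mul
abbrev η : 𝕀 ⟶ A := S.mon.one
abbrev Δ : A ⟶ A ⊡ A := S.comon.comul
abbrev ε : A ⟶ 𝕁 := S.comon.counit

/-- The multiplication is comultiplicative. -/
def WB : Prop := S.μ ≫ S.Δ = (S.Δ ⊚ₘ S.Δ) ≫ ζ A A A A ≫ (S.μ ⊡ₘ S.μ)

/-- The morphism `𝕀 ⟶ 𝕀 ⊡ A ⊡ A ⊡ A` obtained from the unit and twice the comultiplication. -/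
def unitRight : (𝕀 : C) ⟶ 𝕀 ⊡ (A ⊡ (A ⊡ A)) :=
  δ ≫ (𝟙 𝕀 ⊡ₘ S.η) ≫ (𝟙 𝕀 ⊡ₘ S.Δ) ≫ (𝟙 𝕀 ⊡ₘ (𝟙 A ⊡ₘ S.Δ))

/-- The morphism `𝕀 ⟶ A ⊡ A ⊡ A ⊡ 𝕀` obtained from the unit and twice the comultiplication. -/
def unitLeft : (𝕀 : C) ⟶ ((A ⊡ A) ⊡ A) ⊡ 𝕀 :=
  δ ≫ (S.η ⊡ₘ 𝟙 𝕀) ≫ (S.Δ ⊡ₘ 𝟙 𝕀) ≫ ((S.Δ ⊡ₘ 𝟙 A) ⊡ₘ 𝟙 𝕀)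

/-- The morphism `𝕁 ⊚ A ⊚ A ⊚ A ⟶ 𝕁` obtained from twice the multiplication and the counit. -/
def counitLeft : ((𝕁 ⊚ A) ⊚ A) ⊚ A ⟶ 𝕁 :=
  (cα (𝕁 ⊚ A) A A).hom ≫ (𝟙 (𝕁 ⊚ A) ⊚ₘ S.μ) ≫ (cα 𝕁 A A).hom ≫ (𝟙 𝕁 ⊚ₘ S.μ) ≫
    (𝟙 𝕁 ⊚ₘ S.ε) ≫ ϖ

/-- The morphism `A ⊚ A ⊚ A ⊚ 𝕁 ⟶ 𝕁` obtained from twice the multiplication and the counit. -/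
def counitRight : A ⊚ (A ⊚ (A ⊚ 𝕁)) ⟶ 𝕁 :=
  (cα A A (A ⊚ 𝕁)).inv ≫ (S.μ ⊚ₘ 𝟙 (A ⊚ 𝕁)) ≫ (cα A A 𝕁).inv ≫ (S.μ ⊚ₘ 𝟙 𝕁) ≫
    (S.ε ⊚ₘ 𝟙 𝕁) ≫ ϖ

/-! The four weak forms of comultiplicativity of the unit, and the four weak forms of
multiplicativity of the counit. -/

def RRU : Prop :=
  S.unitRight ≫ (bα 𝕀 A (A ⊡ A)).inv ≫ (bα (𝕀 ⊡ A) A A).inv =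
    δ ≫ (𝟙 𝕀 ⊡ₘ (S.η ≫ S.Δ)) ≫ (bα 𝕀 A A).inv ≫
      ((cr (𝕀 ⊡ A)).inv ⊡ₘ 𝟙 A) ≫
      ((𝟙 (𝕀 ⊡ A) ⊚ₘ δ) ⊡ₘ 𝟙 A) ≫
      ((𝟙 (𝕀 ⊡ A) ⊚ₘ (𝟙 𝕀 ⊡ₘ (S.η ≫ S.Δ))) ⊡ₘ 𝟙 A) ≫
      ((𝟙 (𝕀 ⊡ A) ⊚ₘ (bα 𝕀 A A).inv) ⊡ₘ 𝟙 A) ≫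
      (ζ 𝕀 A (𝕀 ⊡ A) A ⊡ₘ 𝟙 A) ≫
      (((cl (𝕀 ⊡ A)).hom ⊡ₘ S.μ) ⊡ₘ 𝟙 A)

def RLU : Prop :=
  S.unitRight ≫ (bα 𝕀 A (A ⊡ A)).inv ≫ (bα (𝕀 ⊡ A) A A).inv =
    δ ≫ (𝟙 𝕀 ⊡ₘ (S.η ≫ S.Δ)) ≫ (bα 𝕀 A A).inv ≫
      ((cl (𝕀 ⊡ A)).inv ⊡ₘ 𝟙 A) ≫
      ((δ ⊚ₘ 𝟙 (𝕀 ⊡ A)) ⊡ₘ 𝟙 A) ≫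
      (((𝟙 𝕀 ⊡ₘ (S.η ≫ S.Δ)) ⊚ₘ 𝟙 (𝕀 ⊡ A)) ⊡ₘ 𝟙 A) ≫
      (((bα 𝕀 A A).inv ⊚ₘ 𝟙 (𝕀 ⊡ A)) ⊡ₘ 𝟙 A) ≫
      (ζ (𝕀 ⊡ A) A 𝕀 A ⊡ₘ 𝟙 A) ≫
      (((cr (𝕀 ⊡ A)).hom ⊡ₘ S.μ) ⊡ₘ 𝟙 A)

def LRU : Prop :=
  S.unitLeft ≫ (bα (A ⊡ A) A 𝕀).hom ≫ (bα A A (A ⊡ 𝕀)).hom =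
    δ ≫ ((S.η ≫ S.Δ) ⊡ₘ 𝟙 𝕀) ≫ (bα A A 𝕀).hom ≫
      (𝟙 A ⊡ₘ (cr (A ⊡ 𝕀)).inv) ≫
      (𝟙 A ⊡ₘ (𝟙 (A ⊡ 𝕀) ⊚ₘ δ)) ≫
      (𝟙 A ⊡ₘ (𝟙 (A ⊡ 𝕀) ⊚ₘ ((S.η ≫ S.Δ) ⊡ₘ 𝟙 𝕀))) ≫
      (𝟙 A ⊡ₘ (𝟙 (A ⊡ 𝕀) ⊚ₘ (bα A A 𝕀).hom)) ≫
      (𝟙 A ⊡ₘ ζ A 𝕀 A (A ⊡ 𝕀)) ≫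
      (𝟙 A ⊡ₘ (S.μ ⊡ₘ (cl (A ⊡ 𝕀)).hom))

def LLU : Prop :=
  S.unitLeft ≫ (bα (A ⊡ A) A 𝕀).hom ≫ (bα A A (A ⊡ 𝕀)).hom =
    δ ≫ ((S.η ≫ S.Δ) ⊡ₘ 𝟙 𝕀) ≫ (bα A A 𝕀).hom ≫
      (𝟙 A ⊡ₘ (cl (A ⊡ 𝕀)).inv) ≫
      (𝟙 A ⊡ₘ (δ ⊚ₘ 𝟙 (A ⊡ 𝕀))) ≫
      (𝟙 A ⊡ₘ (((S.η ≫ S.Δ) ⊡ₘ 𝟙 𝕀) ⊚ₘ 𝟙 (A ⊡ 𝕀))) ≫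
      (𝟙 A ⊡ₘ ((bα A A 𝕀).hom ⊚ₘ 𝟙 (A ⊡ 𝕀))) ≫
      (𝟙 A ⊡ₘ ζ A (A ⊡ 𝕀) A 𝕀) ≫
      (𝟙 A ⊡ₘ (S.μ ⊡ₘ (cr (A ⊡ 𝕀)).hom))

def LRC : Prop :=
  S.counitLeft =
    ((𝟙 (𝕁 ⊚ A) ⊚ₘ S.Δ) ⊚ₘ 𝟙 A) ≫
      (((br (𝕁 ⊚ A)).inv ⊚ₘ 𝟙 (A ⊡ A)) ⊚ₘ 𝟙 A) ≫
      (ζ (𝕁 ⊚ A) 𝕁 A A ⊚ₘ 𝟙 A) ≫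
      (((cα 𝕁 A A).hom ⊡ₘ 𝟙 (𝕁 ⊚ A)) ⊚ₘ 𝟙 A) ≫
      (((𝟙 𝕁 ⊚ₘ (S.μ ≫ S.ε)) ⊡ₘ 𝟙 (𝕁 ⊚ A)) ⊚ₘ 𝟙 A) ≫
      ((ϖ ⊡ₘ 𝟙 (𝕁 ⊚ A)) ⊚ₘ 𝟙 A) ≫
      ((bl (𝕁 ⊚ A)).hom ⊚ₘ 𝟙 A) ≫
      (cα 𝕁 A A).hom ≫ (𝟙 𝕁 ⊚ₘ (S.μ ≫ S.ε)) ≫ ϖ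

def LLC : Prop :=
  S.counitLeft =
    ((𝟙 (𝕁 ⊚ A) ⊚ₘ S.Δ) ⊚ₘ 𝟙 A) ≫
      (((bl (𝕁 ⊚ A)).inv ⊚ₘ 𝟙 (A ⊡ A)) ⊚ₘ 𝟙 A) ≫
      (ζ 𝕁 (𝕁 ⊚ A) A A ⊚ₘ 𝟙 A) ≫
      ((𝟙 (𝕁 ⊚ A) ⊡ₘ (cα 𝕁 A A).hom) ⊚ₘ 𝟙 A) ≫
      ((𝟙 (𝕁 ⊚ A) ⊡ₘ (𝟙 𝕁 ⊚ₘ (S.μ ≫ S.ε))) ⊚ₘ 𝟙 A) ≫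
      ((𝟙 (𝕁 ⊚ A) ⊡ₘ ϖ) ⊚ₘ 𝟙 A) ≫
      ((br (𝕁 ⊚ A)).hom ⊚ₘ 𝟙 A) ≫
      (cα 𝕁 A A).hom ≫ (𝟙 𝕁 ⊚ₘ (S.μ ≫ S.ε)) ≫ ϖ

def RRC : Prop :=
  S.counitRight =
    (𝟙 A ⊚ₘ (S.Δ ⊚ₘ 𝟙 (A ⊚ 𝕁))) ≫
      (𝟙 A ⊚ₘ (𝟙 (A ⊡ A) ⊚ₘ (br (A ⊚ 𝕁)).inv)) ≫
      (𝟙 A ⊚ₘ ζ A A (A ⊚ 𝕁) 𝕁) ≫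
      (𝟙 A ⊚ₘ ((cα A A 𝕁).inv ⊡ₘ 𝟙 (A ⊚ 𝕁))) ≫
      (𝟙 A ⊚ₘ (((S.μ ≫ S.ε) ⊚ₘ 𝟙 𝕁) ⊡ₘ 𝟙 (A ⊚ 𝕁))) ≫
      (𝟙 A ⊚ₘ (ϖ ⊡ₘ 𝟙 (A ⊚ 𝕁))) ≫
      (𝟙 A ⊚ₘ (bl (A ⊚ 𝕁)).hom) ≫
      (cα A A 𝕁).inv ≫ ((S.μ ≫ S.ε) ⊚ₘ 𝟙 𝕁) ≫ ϖ

def RLC : Prop :=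
  S.counitRight =
    (𝟙 A ⊚ₘ (S.Δ ⊚ₘ 𝟙 (A ⊚ 𝕁))) ≫
      (𝟙 A ⊚ₘ (𝟙 (A ⊡ A) ⊚ₘ (bl (A ⊚ 𝕁)).inv)) ≫
      (𝟙 A ⊚ₘ ζ A A 𝕁 (A ⊚ 𝕁)) ≫
      (𝟙 A ⊚ₘ (𝟙 (A ⊚ 𝕁) ⊡ₘ (cα A A 𝕁).inv)) ≫
      (𝟙 A ⊚ₘ (𝟙 (A ⊚ 𝕁) ⊡ₘ ((S.μ ≫ S.ε) ⊚ₘ 𝟙 𝕁))) ≫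
      (𝟙 A ⊚ₘ (𝟙 (A ⊚ 𝕁) ⊡ₘ ϖ)) ≫
      (𝟙 A ⊚ₘ (br (A ⊚ 𝕁)).hom) ≫
      (cα A A 𝕁).inv ≫ ((S.μ ≫ S.ε) ⊚ₘ 𝟙 𝕁) ≫ ϖ

/-- The monad `A ⊚ (-)`. -/
abbrev circMonad : Monad C := @leftMonad C _ circ A S.mon

/-- The comonad `(-) ⊡ A`. -/
abbrev bulRightComonad : Comonad C := @rightComonad C _ bul A S.comon

/-- The comonad `A ⊡ (-)`. -/
abbrev bulLeftComonad : Comonad C := @leftComonad C _ bul A S.comon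

end MonoidComonoid

end Duoidal

/-!
A weak bimonad `T` induces an opmonoidal structure `(T₂, T₀)` on its functor, and conversely the weak
bimonad can be rebuilt from `(T₂, T₀)` whenever this structure satisfies the axioms of
`WeakOpmonoidal`. Given two `T`-algebras, `T₂` makes `T` act on the product of the underlying objects,
associatively but not unitally: the unit acts by an idempotent (`idem`). The tensor product of the
two algebras is the splitting of this idempotent, and the two halves `π`, `ι` of the splitting are
the monoidal and the opmonoidal structure of the forgetful functor; so separability is built in. On a
threefold product the unit acts by the composite of the two partial idempotents (`η_actLeft`), which
is the Frobenius condition, and both bracketings of a threefold tensor product split this same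
idempotent, whence the associator. The unit object is the splitting of an idempotent on `TK` (`proj`;
for a weak bialgebra, `x ↦ ε(1₁ x) 1₂`), the inverse of the left unitor inserts the unit element
(`θ_unit_idem`, `map_θ_a`), and everything on the right follows by reversal of the tensor product.
Since `π` followed by `ι` is the idempotent, `T₂` and `T₀` are recovered
(`WeakOpmonoidal.exists_weakBimonad`).

For `T = A ⊚ -` in a duoidal category, with `T₂` made of `Δ` and `ζ`, the opmonoidal axioms and the
compatibility with the multiplication come from the comonoid axioms, the associativity of `ζ` and
`WB`. The conditions `RRC` and `RLC` are, up to associativity of the multiplication, the axioms on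
`T₀`. The conditions `RLU` and `LLU` are identities between morphisms out of `𝕀`; letting both sides
act on a product of three objects, and using that the extra factor `𝕀` in them acts trivially, one
gets the axioms on the unit (`χ_opMul`, `opMul_χ`).

The opposite category, with `⊚` and `⊡` interchanged, is duoidal again (`opDuoidal`); a monoid and
comonoid in the one is a monoid and comonoid in the other, `A ⊡ -` becomes `A ⊚ -`, and `LRC`, `RRC`,
`LRU`, `LLU` become `RLU`, `LLU`, `RLC`, `RRC`. This yields the statement about `A ⊡ -`, and the one
about `- ⊡ A` follows in the duoidal category with the factors of `⊡` interchanged (`revDuoidal`).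
-/

/-! ### Weakly opmonoidal monads and the tensor product of algebras -/

/-- A weakly opmonoidal structure on a monad `T`: an opmonoidal structure `(t2, t0)` on the functor
`T`, whose binary part is compatible with the multiplication (`mul_t2`). Instead of asking the unit
to be opmonoidal one asks `unit_left` and `unit_right`, two weak forms of the compatibility of the
unit with `t2`; instead of asking the multiplication to be compatible with `t0` one asks
`counit_mul_left` and `counit_mul_right`, the weak multiplicativity of the counit.

The axioms are written with `⊗ₘ` only, in which the axioms of a duoidal category are written too. -/
structure WeakOpmonoidal {C : Type u} [Category.{v} C] [MonoidalCategory C] (T : Monad C) where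
  t2 : ∀ X Y : C, T.obj (X ⊗ Y) ⟶ T.obj X ⊗ T.obj Y
  t0 : T.obj (𝟙_ C) ⟶ 𝟙_ C
  natural : ∀ {X X' Y Y' : C} (f : X ⟶ X') (g : Y ⟶ Y'),
    T.map (f ⊗ₘ g) ≫ t2 X' Y' = t2 X Y ≫ (T.map f ⊗ₘ T.map g)
  coassoc : ∀ X Y Z : C, t2 (X ⊗ Y) Z ≫ (t2 X Y ⊗ₘ 𝟙 (T.obj Z)) ≫ (α_ _ _ _).hom =
    T.map (α_ X Y Z).hom ≫ t2 X (Y ⊗ Z) ≫ (𝟙 (T.obj X) ⊗ₘ t2 Y Z)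
  counit_left : ∀ X : C, t2 (𝟙_ C) X ≫ (t0 ⊗ₘ 𝟙 (T.obj X)) ≫ (λ_ _).hom = T.map (λ_ X).hom
  counit_right : ∀ X : C, t2 X (𝟙_ C) ≫ (𝟙 (T.obj X) ⊗ₘ t0) ≫ (ρ_ _).hom = T.map (ρ_ X).hom
  mul_t2 : ∀ X Y : C, T.μ.app (X ⊗ Y) ≫ t2 X Y =
    T.map (t2 X Y) ≫ t2 (T.obj X) (T.obj Y) ≫ (T.μ.app X ⊗ₘ T.μ.app Y)
  unit_left : ∀ X Y Z : C, T.η.app (X ⊗ (Y ⊗ Z)) ≫ t2 X (Y ⊗ Z) ≫ (𝟙 (T.obj X) ⊗ₘ t2 Y Z) =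
    (𝟙 X ⊗ₘ (T.η.app (Y ⊗ Z) ≫ t2 Y Z)) ≫ (α_ _ _ _).inv ≫
      ((T.η.app (X ⊗ T.obj Y) ≫ t2 X (T.obj Y) ≫ (𝟙 (T.obj X) ⊗ₘ T.μ.app Y)) ⊗ₘ 𝟙 (T.obj Z)) ≫
      (α_ _ _ _).hom
  unit_right : ∀ X Y Z : C, T.η.app ((X ⊗ Y) ⊗ Z) ≫ t2 (X ⊗ Y) Z ≫ (t2 X Y ⊗ₘ 𝟙 (T.obj Z)) =
    ((T.η.app (X ⊗ Y) ≫ t2 X Y) ⊗ₘ 𝟙 Z) ≫ (α_ _ _ _).hom ≫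
      (𝟙 (T.obj X) ⊗ₘ (T.η.app (T.obj Y ⊗ Z) ≫ t2 (T.obj Y) Z ≫ (T.μ.app Y ⊗ₘ 𝟙 (T.obj Z)))) ≫
      (α_ _ _ _).inv
  counit_mul_left : T.map (T.map (ρ_ (T.obj (𝟙_ C))).inv ≫ t2 (T.obj (𝟙_ C)) (𝟙_ C) ≫
      ((T.μ.app (𝟙_ C) ≫ t0) ⊗ₘ 𝟙 (T.obj (𝟙_ C))) ≫ (λ_ (T.obj (𝟙_ C))).hom) ≫
      T.μ.app (𝟙_ C) ≫ t0 = T.map (T.μ.app (𝟙_ C)) ≫ T.μ.app (𝟙_ C) ≫ t0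
  counit_mul_right : T.map (T.map (λ_ (T.obj (𝟙_ C))).inv ≫ t2 (𝟙_ C) (T.obj (𝟙_ C)) ≫
      (𝟙 (T.obj (𝟙_ C)) ⊗ₘ (T.μ.app (𝟙_ C) ≫ t0)) ≫ (ρ_ (T.obj (𝟙_ C))).hom) ≫
      T.μ.app (𝟙_ C) ≫ t0 = T.map (T.μ.app (𝟙_ C)) ≫ T.μ.app (𝟙_ C) ≫ t0

namespace WeakOpmonoidal
section Tensor
variable {C : Type u} [Category.{v} C] [MonoidalCategory C] {T : Monad C} (D : WeakOpmonoidal T)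

theorem t2_natural_left {X X' : C} (f : X ⟶ X') (Y : C) :
    T.map (f ▷ Y) ≫ D.t2 X' Y = D.t2 X Y ≫ T.map f ▷ T.obj Y := by
  simpa using D.natural f (𝟙 Y)

theorem t2_natural_right (X : C) {Y Y' : C} (f : Y ⟶ Y') :
    T.map (X ◁ f) ≫ D.t2 X Y' = D.t2 X Y ≫ T.obj X ◁ T.map f := by
  simpa using D.natural (𝟙 X) f

/-- The (non-unital) action on the product of the underlying objects of two algebras. -/
def act (X Y : T.Algebra) : T.obj (X.A ⊗ Y.A) ⟶ X.A ⊗ Y.A := D.t2 X.A Y.A ≫ (X.a ⊗ₘ Y.a)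

theorem mul_act (X Y : T.Algebra) :
    T.μ.app (X.A ⊗ Y.A) ≫ D.act X Y = T.map (D.act X Y) ≫ D.act X Y := by
  simp only [act, Functor.map_comp, Category.assoc]
  rw [reassoc_of% (D.natural X.a Y.a), reassoc_of% (D.mul_t2 X.A Y.A)]
  simp [← X.assoc, ← Y.assoc]

theorem act_natural {X X' Y Y' : T.Algebra} (f : X ⟶ X') (g : Y ⟶ Y') :
    T.map (f.f ⊗ₘ g.f) ≫ D.act X' Y' = D.act X Y ≫ (f.f ⊗ₘ g.f) := by
  simp only [act, Category.assoc]
  rw [reassoc_of% (D.natural f.f g.f)]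
  simp

/-- The idempotent through which the unit of `T` acts on a product of two algebras. -/
def idem (X Y : T.Algebra) : X.A ⊗ Y.A ⟶ X.A ⊗ Y.A := T.η.app _ ≫ D.act X Y

theorem map_idem_act (X Y : T.Algebra) : T.map (D.idem X Y) ≫ D.act X Y = D.act X Y := by
  rw [idem, Functor.map_comp, Category.assoc, ← mul_act, T.right_unit_assoc]

theorem act_idem (X Y : T.Algebra) : D.act X Y ≫ D.idem X Y = D.act X Y := by
  have h := T.η.naturality (D.act X Y)
  simp only [Functor.id_map] at h
  rw [idem, reassoc_of% h, ← mul_act]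
  exact T.left_unit_assoc _ _

theorem idem_idem (X Y : T.Algebra) : D.idem X Y ≫ D.idem X Y = D.idem X Y := by
  nth_rw 1 [idem]
  rw [Category.assoc, act_idem, idem]

theorem idem_natural {X X' Y Y' : T.Algebra} (f : X ⟶ X') (g : Y ⟶ Y') :
    (f.f ⊗ₘ g.f) ≫ D.idem X' Y' = D.idem X Y ≫ (f.f ⊗ₘ g.f) := by
  have h := T.η.naturality (f.f ⊗ₘ g.f)
  simp only [Functor.id_map] at h
  rw [idem, reassoc_of% h, act_natural, idem, Category.assoc]

variable [IsIdempotentComplete C]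

/-- The splitting of `idem X Y` carries a unique algebra structure making both halves of the
splitting compatible with the action on the product. -/
theorem exists_splitting (X Y : T.Algebra) :
    ∃ (Z : T.Algebra) (i : Z.A ⟶ X.A ⊗ Y.A) (p : X.A ⊗ Y.A ⟶ Z.A),
      (i ≫ p = 𝟙 Z.A ∧ p ≫ i = D.idem X Y) ∧
      T.map i ≫ D.act X Y = Z.a ≫ i ∧ T.map p ≫ Z.a = D.act X Y ≫ p := by
  obtain ⟨Z, i, p, hip, hpi⟩ := IsIdempotentComplete.idempotents_split _ _ (D.idem_idem X Y)
  have hp : T.η.app _ ≫ D.act X Y ≫ p = p := by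
    have : D.idem X Y ≫ p = p := by rw [← hpi, Category.assoc, hip, Category.comp_id]
    rw [← Category.assoc]; exact this
  have hT : T.map p ≫ T.map i ≫ D.act X Y = D.act X Y := by
    rw [← T.toFunctor.map_comp_assoc, hpi, map_idem_act]
  have h₁ := T.η.naturality i
  have h₂ := T.μ.naturality i
  simp only [Functor.id_map, Functor.comp_map] at h₁ h₂
  refine ⟨⟨Z, T.map i ≫ D.act X Y ≫ p, ?_, ?_⟩, i, p, ⟨hip, hpi⟩, ?_, ?_⟩
  · rw [← reassoc_of% h₁, hp, hip]
  · rw [← reassoc_of% h₂, reassoc_of% (D.mul_act X Y)]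
    simp only [Functor.map_comp, Category.assoc]
    rw [reassoc_of% hT]
  · simp only [Category.assoc, hpi, act_idem]
  · simp only [reassoc_of% hT]

/-- The tensor product of two algebras: the splitting of `idem`. -/
noncomputable def tensor (X Y : T.Algebra) : T.Algebra := (D.exists_splitting X Y).choose

/-- The inclusion of the tensor product of two algebras into that of the underlying objects. -/
noncomputable def ι (X Y : T.Algebra) : (D.tensor X Y).A ⟶ X.A ⊗ Y.A :=
  (D.exists_splitting X Y).choose_spec.choose

/-- The projection onto the tensor product of two algebras from that of the underlying objects. -/
noncomputable def π (X Y : T.Algebra) : X.A ⊗ Y.A ⟶ (D.tensor X Y).A :=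
  (D.exists_splitting X Y).choose_spec.choose_spec.choose

theorem ι_π (X Y : T.Algebra) : D.ι X Y ≫ D.π X Y = 𝟙 _ :=
  (D.exists_splitting X Y).choose_spec.choose_spec.choose_spec.1.1

theorem π_ι (X Y : T.Algebra) : D.π X Y ≫ D.ι X Y = D.idem X Y :=
  (D.exists_splitting X Y).choose_spec.choose_spec.choose_spec.1.2

theorem map_ι_act (X Y : T.Algebra) :
    T.map (D.ι X Y) ≫ D.act X Y = (D.tensor X Y).a ≫ D.ι X Y :=
  (D.exists_splitting X Y).choose_spec.choose_spec.choose_spec.2.1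

theorem map_π_a (X Y : T.Algebra) :
    T.map (D.π X Y) ≫ (D.tensor X Y).a = D.act X Y ≫ D.π X Y :=
  (D.exists_splitting X Y).choose_spec.choose_spec.choose_spec.2.2

theorem ι_idem (X Y : T.Algebra) : D.ι X Y ≫ D.idem X Y = D.ι X Y := by
  rw [← π_ι, reassoc_of% (D.ι_π X Y)]

theorem idem_π (X Y : T.Algebra) : D.idem X Y ≫ D.π X Y = D.π X Y := by
  rw [← π_ι, Category.assoc, ι_π, Category.comp_id]

/-- The tensor product of two morphisms of algebras. -/
noncomputable def tensorMap {X X' Y Y' : T.Algebra} (f : X ⟶ X') (g : Y ⟶ Y') :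
    D.tensor X Y ⟶ D.tensor X' Y' where
  f := D.ι X Y ≫ (f.f ⊗ₘ g.f) ≫ D.π X' Y'
  h := by
    simp only [Functor.map_comp, Category.assoc, map_π_a]
    rw [reassoc_of% (D.act_natural f g), reassoc_of% (D.map_ι_act X Y)]

theorem tensorMap_ι {X X' Y Y' : T.Algebra} (f : X ⟶ X') (g : Y ⟶ Y') :
    (D.tensorMap f g).f ≫ D.ι X' Y' = D.ι X Y ≫ (f.f ⊗ₘ g.f) := by
  simp only [tensorMap, Category.assoc, π_ι, idem_natural]
  rw [reassoc_of% (D.ι_idem X Y)]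

theorem π_tensorMap {X X' Y Y' : T.Algebra} (f : X ⟶ X') (g : Y ⟶ Y') :
    D.π X Y ≫ (D.tensorMap f g).f = (f.f ⊗ₘ g.f) ≫ D.π X' Y' := by
  simp only [tensorMap]
  rw [reassoc_of% (D.π_ι X Y), ← reassoc_of% (D.idem_natural f g), idem_π]

theorem cancel_ι {Z : C} {X Y : T.Algebra} {f g : Z ⟶ (D.tensor X Y).A}
    (h : f ≫ D.ι X Y = g ≫ D.ι X Y) : f = g := by
  have := congrArg (fun k => k ≫ D.π X Y) h
  simpa [ι_π] using this

end Tensor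
/-! ### Threefold tensor products and the associator -/

section Associator
variable {C : Type u} [Category.{v} C] [MonoidalCategory C] {T : Monad C} (D : WeakOpmonoidal T)

/-- The (non-unital) action on a threefold product bracketed to the right. -/
def actRight (X Y Z : T.Algebra) : T.obj (X.A ⊗ Y.A ⊗ Z.A) ⟶ X.A ⊗ Y.A ⊗ Z.A :=
  D.t2 X.A (Y.A ⊗ Z.A) ≫ (X.a ⊗ₘ D.act Y Z)

/-- The (non-unital) action on a threefold product bracketed to the left. -/
def actLeft (X Y Z : T.Algebra) : T.obj ((X.A ⊗ Y.A) ⊗ Z.A) ⟶ (X.A ⊗ Y.A) ⊗ Z.A :=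
  D.t2 (X.A ⊗ Y.A) Z.A ≫ (D.act X Y ⊗ₘ Z.a)

theorem actLeft_associator (X Y Z : T.Algebra) :
    D.actLeft X Y Z ≫ (α_ _ _ _).hom = T.map (α_ _ _ _).hom ≫ D.actRight X Y Z := by
  have h := D.coassoc X.A Y.A Z.A
  have e₁ : (D.act X Y ⊗ₘ Z.a) = (D.t2 X.A Y.A ⊗ₘ 𝟙 _) ≫ ((X.a ⊗ₘ Y.a) ⊗ₘ Z.a) := by
    simp only [act, tensorHom_comp_tensorHom, Category.id_comp]
  have e₂ : (X.a ⊗ₘ D.act Y Z) = (𝟙 _ ⊗ₘ D.t2 Y.A Z.A) ≫ (X.a ⊗ₘ (Y.a ⊗ₘ Z.a)) := by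
    simp only [act, tensorHom_comp_tensorHom, Category.id_comp]
  rw [actLeft, actRight, e₁, e₂, ← reassoc_of% h, Category.assoc, Category.assoc,
    associator_naturality]

/-- The unit acts on a threefold product by the two partial idempotents, one after the other; this
is what `unit_right` says about arbitrary algebras. -/
theorem η_actLeft (X Y Z : T.Algebra) :
    T.η.app _ ≫ D.actLeft X Y Z =
      D.idem X Y ▷ Z.A ≫ (α_ _ _ _).hom ≫ X.A ◁ D.idem Y Z ≫ (α_ _ _ _).inv := by
  have h := congrArg (fun k => k ≫ ((X.a ⊗ₘ Y.a) ⊗ₘ Z.a)) (D.unit_right X.A Y.A Z.A)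
  have e₁ : (D.act X Y ⊗ₘ Z.a) = (D.t2 X.A Y.A ⊗ₘ 𝟙 _) ≫ ((X.a ⊗ₘ Y.a) ⊗ₘ Z.a) := by
    simp only [act, tensorHom_comp_tensorHom, Category.id_comp]
  simp only [Category.assoc] at h
  rw [actLeft, e₁, h, ← associator_inv_naturality, ← Category.assoc (_ ⊗ₘ _) _ (α_ _ _ _).inv,
    tensorHom_comp_tensorHom]
  have h₁ := T.η.naturality (Y.a ▷ Z.A)
  simp only [Functor.id_map] at h₁
  have h₂ : (T.η.app (T.obj Y.A ⊗ Z.A) ≫ D.t2 (T.obj Y.A) Z.A ≫ (T.μ.app Y.A ⊗ₘ 𝟙 (T.obj Z.A))) ≫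
      (Y.a ⊗ₘ Z.a) = Y.a ▷ Z.A ≫ D.idem Y Z := by
    rw [idem, reassoc_of% h₁, act, reassoc_of% (D.t2_natural_left Y.a Z.A)]
    simp only [← tensorHom_id, Category.assoc, tensorHom_comp_tensorHom, Category.id_comp, Y.assoc]
  rw [h₂, Category.id_comp]
  have h₃ : D.idem X Y = (T.η.app (X.A ⊗ Y.A) ≫ D.t2 X.A Y.A) ≫ (X.a ⊗ₘ Y.a) := by
    simp [idem, act]
  have h₄ : (X.a ⊗ₘ Y.a ▷ Z.A ≫ D.idem Y Z) = (X.a ⊗ₘ Y.a ▷ Z.A) ≫ X.A ◁ D.idem Y Z := by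
    rw [← id_tensorHom, tensorHom_comp_tensorHom, Category.comp_id]
  rw [h₃, h₄, comp_whiskerRight, Category.assoc, Category.assoc,
    ← tensorHom_id Y.a, ← associator_naturality_assoc]
  simp only [tensorHom_id]

variable [IsIdempotentComplete C]

theorem map_whiskerLeft_ι_actRight (X Y Z : T.Algebra) :
    T.map (X.A ◁ D.ι Y Z) ≫ D.actRight X Y Z = D.act X (D.tensor Y Z) ≫ X.A ◁ D.ι Y Z := by
  conv_rhs => rw [act]
  rw [actRight, reassoc_of% (D.t2_natural_right X.A (D.ι Y Z))]
  simp only [← id_tensorHom, Category.assoc, tensorHom_comp_tensorHom,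
    Category.comp_id, Category.id_comp, D.map_ι_act]

theorem map_whiskerRight_ι_actLeft (X Y Z : T.Algebra) :
    T.map (D.ι X Y ▷ Z.A) ≫ D.actLeft X Y Z = D.act (D.tensor X Y) Z ≫ D.ι X Y ▷ Z.A := by
  conv_rhs => rw [act]
  rw [actLeft, reassoc_of% (D.t2_natural_left (D.ι X Y) Z.A)]
  simp only [← tensorHom_id, Category.assoc, tensorHom_comp_tensorHom,
    Category.comp_id, Category.id_comp, D.map_ι_act]

/-- The composite inclusion of a threefold tensor product bracketed to the right. -/
noncomputable def ιRight (X Y Z : T.Algebra) :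
    (D.tensor X (D.tensor Y Z)).A ⟶ X.A ⊗ Y.A ⊗ Z.A := D.ι X (D.tensor Y Z) ≫ X.A ◁ D.ι Y Z

/-- The composite projection to a threefold tensor product bracketed to the right. -/
noncomputable def πRight (X Y Z : T.Algebra) :
    X.A ⊗ Y.A ⊗ Z.A ⟶ (D.tensor X (D.tensor Y Z)).A := X.A ◁ D.π Y Z ≫ D.π X (D.tensor Y Z)

/-- The composite inclusion of a threefold tensor product bracketed to the left. -/
noncomputable def ιLeft (X Y Z : T.Algebra) :
    (D.tensor (D.tensor X Y) Z).A ⟶ (X.A ⊗ Y.A) ⊗ Z.A := D.ι (D.tensor X Y) Z ≫ D.ι X Y ▷ Z.A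

/-- The composite projection to a threefold tensor product bracketed to the left. -/
noncomputable def πLeft (X Y Z : T.Algebra) :
    (X.A ⊗ Y.A) ⊗ Z.A ⟶ (D.tensor (D.tensor X Y) Z).A := D.π X Y ▷ Z.A ≫ D.π (D.tensor X Y) Z

theorem ιRight_πRight (X Y Z : T.Algebra) : D.ιRight X Y Z ≫ D.πRight X Y Z = 𝟙 _ := by
  simp only [ιRight, πRight, Category.assoc]
  rw [← MonoidalCategory.whiskerLeft_comp_assoc, ι_π]
  simp [ι_π]

theorem ιLeft_πLeft (X Y Z : T.Algebra) : D.ιLeft X Y Z ≫ D.πLeft X Y Z = 𝟙 _ := by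
  simp only [ιLeft, πLeft, Category.assoc]
  rw [← comp_whiskerRight_assoc, ι_π]
  simp [ι_π]

theorem πRight_ιRight (X Y Z : T.Algebra) :
    D.πRight X Y Z ≫ D.ιRight X Y Z = T.η.app _ ≫ D.actRight X Y Z := by
  have h₁ := T.η.naturality (X.A ◁ D.π Y Z)
  simp only [Functor.id_map] at h₁
  simp only [ιRight, πRight, Category.assoc]
  rw [reassoc_of% (D.π_ι X (D.tensor Y Z)), idem, Category.assoc, ← map_whiskerLeft_ι_actRight,
    reassoc_of% h₁, ← T.toFunctor.map_comp_assoc, ← MonoidalCategory.whiskerLeft_comp, π_ι,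
    actRight, reassoc_of% (D.t2_natural_right X.A (D.idem Y Z))]
  simp only [← id_tensorHom, tensorHom_comp_tensorHom, Category.id_comp,
    map_idem_act]

/-- The left bracketing splits the idempotent by which the unit of `T` acts on the threefold product.
So does the right one (`πRight_ιRight`); hence the associator below is invertible. -/
theorem πLeft_ιLeft (X Y Z : T.Algebra) :
    D.πLeft X Y Z ≫ D.ιLeft X Y Z = T.η.app _ ≫ D.actLeft X Y Z := by
  have h₁ := T.η.naturality (D.π X Y ▷ Z.A)
  simp only [Functor.id_map] at h₁
  simp only [ιLeft, πLeft, Category.assoc]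
  rw [reassoc_of% (D.π_ι (D.tensor X Y) Z), idem, Category.assoc, ← map_whiskerRight_ι_actLeft,
    reassoc_of% h₁, ← T.toFunctor.map_comp_assoc, ← comp_whiskerRight, π_ι,
    actLeft, reassoc_of% (D.t2_natural_left (D.idem X Y) Z.A)]
  simp only [← tensorHom_id, tensorHom_comp_tensorHom, Category.id_comp,
    map_idem_act]

theorem πLeft_ιLeft_associator (X Y Z : T.Algebra) :
    D.πLeft X Y Z ≫ D.ιLeft X Y Z ≫ (α_ _ _ _).hom =
      (α_ _ _ _).hom ≫ D.πRight X Y Z ≫ D.ιRight X Y Z := by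
  have h₁ := T.η.naturality (α_ X.A Y.A Z.A).hom
  simp only [Functor.id_map] at h₁
  rw [reassoc_of% (D.πLeft_ιLeft X Y Z), actLeft_associator, πRight_ιRight, reassoc_of% h₁]

theorem map_ιRight_actRight (X Y Z : T.Algebra) :
    T.map (D.ιRight X Y Z) ≫ D.actRight X Y Z =
      (D.tensor X (D.tensor Y Z)).a ≫ D.ιRight X Y Z := by
  rw [ιRight, Functor.map_comp, Category.assoc, map_whiskerLeft_ι_actRight,
    reassoc_of% (D.map_ι_act X (D.tensor Y Z))]

theorem map_ιLeft_actLeft (X Y Z : T.Algebra) :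
    T.map (D.ιLeft X Y Z) ≫ D.actLeft X Y Z =
      (D.tensor (D.tensor X Y) Z).a ≫ D.ιLeft X Y Z := by
  rw [ιLeft, Functor.map_comp, Category.assoc, map_whiskerRight_ι_actLeft,
    reassoc_of% (D.map_ι_act (D.tensor X Y) Z)]

theorem cancel_ιRight {W : C} {X Y Z : T.Algebra} {f g : W ⟶ (D.tensor X (D.tensor Y Z)).A}
    (h : f ≫ D.ιRight X Y Z = g ≫ D.ιRight X Y Z) : f = g := by
  have := congrArg (fun k => k ≫ D.πRight X Y Z) h
  simpa [ιRight_πRight] using this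

theorem cancel_ιLeft {W : C} {X Y Z : T.Algebra} {f g : W ⟶ (D.tensor (D.tensor X Y) Z).A}
    (h : f ≫ D.ιLeft X Y Z = g ≫ D.ιLeft X Y Z) : f = g := by
  have := congrArg (fun k => k ≫ D.πLeft X Y Z) h
  simpa [ιLeft_πLeft] using this

theorem ιLeft_associator_πRight_ιRight (X Y Z : T.Algebra) :
    (D.ιLeft X Y Z ≫ (α_ _ _ _).hom ≫ D.πRight X Y Z) ≫ D.ιRight X Y Z =
      D.ιLeft X Y Z ≫ (α_ _ _ _).hom := by
  simp only [Category.assoc]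
  rw [← πLeft_ιLeft_associator, reassoc_of% (D.ιLeft_πLeft X Y Z)]

theorem ιRight_associator_inv_πLeft_ιLeft (X Y Z : T.Algebra) :
    (D.ιRight X Y Z ≫ (α_ _ _ _).inv ≫ D.πLeft X Y Z) ≫ D.ιLeft X Y Z =
      D.ιRight X Y Z ≫ (α_ _ _ _).inv := by
  rw [← cancel_mono (α_ X.A Y.A Z.A).hom]
  simp only [Category.assoc, πLeft_ιLeft_associator, Iso.inv_hom_id_assoc, Iso.inv_hom_id]
  rw [reassoc_of% (D.ιRight_πRight X Y Z), Category.comp_id]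

/-- The associator of algebras. -/
noncomputable def assoc (X Y Z : T.Algebra) :
    D.tensor (D.tensor X Y) Z ≅ D.tensor X (D.tensor Y Z) :=
  Monad.Algebra.isoMk
    { hom := D.ιLeft X Y Z ≫ (α_ _ _ _).hom ≫ D.πRight X Y Z
      inv := D.ιRight X Y Z ≫ (α_ _ _ _).inv ≫ D.πLeft X Y Z
      hom_inv_id := by
        apply cancel_ιLeft
        rw [Category.assoc, ιRight_associator_inv_πLeft_ιLeft, ← Category.assoc,
          ιLeft_associator_πRight_ιRight]
        simp
      inv_hom_id := by
        apply cancel_ιRight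
        rw [Category.assoc, ιLeft_associator_πRight_ιRight, ← Category.assoc,
          ιRight_associator_inv_πLeft_ιLeft]
        simp }
    (by
      apply cancel_ιRight
      dsimp only
      rw [Category.assoc, ← map_ιRight_actRight, Category.assoc,
        ← T.toFunctor.map_comp_assoc, D.ιLeft_associator_πRight_ιRight, Functor.map_comp,
        Category.assoc, ← actLeft_associator, reassoc_of% (D.map_ιLeft_actLeft X Y Z)])

theorem assoc_hom_f (X Y Z : T.Algebra) :
    (D.assoc X Y Z).hom.f = D.ιLeft X Y Z ≫ (α_ _ _ _).hom ≫ D.πRight X Y Z := rfl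

theorem assoc_hom_ι (X Y Z : T.Algebra) :
    (D.assoc X Y Z).hom.f ≫ D.ιRight X Y Z = D.ιLeft X Y Z ≫ (α_ _ _ _).hom :=
  D.ιLeft_associator_πRight_ιRight X Y Z

theorem π_assoc_hom (X Y Z : T.Algebra) :
    D.πLeft X Y Z ≫ (D.assoc X Y Z).hom.f = (α_ _ _ _).hom ≫ D.πRight X Y Z := by
  apply cancel_ιRight
  rw [Category.assoc, assoc_hom_ι, πLeft_ιLeft_associator, Category.assoc]

end Associator
/-! ### The unit algebra -/

section Unit
variable {C : Type u} [Category.{v} C] [MonoidalCategory C] {T : Monad C} (D : WeakOpmonoidal T)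

/-- The counit applied to a product. -/
def κ : T.obj (T.obj (𝟙_ C)) ⟶ 𝟙_ C := T.μ.app (𝟙_ C) ≫ D.t0

/-- The part `y ⊗ x ↦ ε(y₁ x) y₂` of the coproduct of `y`, evaluated on `x`, if `T` is the functor
`A ⊗ -` of a weak bialgebra `A` with coproduct `y ↦ y₁ ⊗ y₂` and counit `ε`. -/
def ν : T.obj (T.obj (𝟙_ C)) ⟶ T.obj (𝟙_ C) :=
  T.map (ρ_ _).inv ≫ D.t2 (T.obj (𝟙_ C)) (𝟙_ C) ≫ D.κ ▷ _ ≫ (λ_ _).hom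

/-- The mirror image `y ⊗ x ↦ y₁ ε(y₂ x)` of `ν`. -/
def ν' : T.obj (T.obj (𝟙_ C)) ⟶ T.obj (𝟙_ C) :=
  T.map (λ_ _).inv ≫ D.t2 (𝟙_ C) (T.obj (𝟙_ C)) ≫ _ ◁ D.κ ≫ (ρ_ _).hom

/-- The idempotent `x ↦ ε(1₁ x) 1₂`, in the case of a weak bialgebra. Its image is the unit object
among the algebras. -/
def proj : T.obj (𝟙_ C) ⟶ T.obj (𝟙_ C) := T.η.app _ ≫ D.ν

/-- The mirror image `x ↦ 1₁ ε(1₂ x)` of `proj`. -/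
def proj' : T.obj (𝟙_ C) ⟶ T.obj (𝟙_ C) := T.η.app _ ≫ D.ν'

theorem map_ν_κ : T.map D.ν ≫ D.κ = T.map (T.μ.app _) ≫ D.κ := by
  have h := D.counit_mul_left
  rwa [tensorHom_id] at h

theorem map_ν'_κ : T.map D.ν' ≫ D.κ = T.map (T.μ.app _) ≫ D.κ := by
  have h := D.counit_mul_right
  rwa [id_tensorHom] at h

theorem map_μ_κ : T.map (T.μ.app (𝟙_ C)) ≫ D.κ = T.μ.app _ ≫ D.κ := by
  simp only [κ]
  exact (reassoc_of% (T.assoc (𝟙_ C))) D.t0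

theorem map_proj_κ : T.map D.proj ≫ D.κ = D.κ := by
  rw [proj, Functor.map_comp, Category.assoc, map_ν_κ, ← T.toFunctor.map_comp_assoc, T.left_unit]
  simp

theorem map_proj'_κ : T.map D.proj' ≫ D.κ = D.κ := by
  rw [proj', Functor.map_comp, Category.assoc, map_ν'_κ, ← T.toFunctor.map_comp_assoc, T.left_unit]
  simp

theorem comp_proj {Y : C} (f : Y ⟶ T.obj (𝟙_ C)) :
    f ≫ D.proj =
      T.η.app _ ≫ T.map (ρ_ _).inv ≫ D.t2 Y (𝟙_ C) ≫ (T.map f ≫ D.κ) ▷ _ ≫ (λ_ _).hom := by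
  have h := T.η.naturality f
  simp only [Functor.id_map] at h
  rw [proj, ν, reassoc_of% h, ← T.toFunctor.map_comp_assoc, rightUnitor_inv_naturality,
    Functor.map_comp_assoc, reassoc_of% (D.t2_natural_left f (𝟙_ C))]
  simp

theorem comp_proj' {Y : C} (f : Y ⟶ T.obj (𝟙_ C)) :
    f ≫ D.proj' =
      T.η.app _ ≫ T.map (λ_ _).inv ≫ D.t2 (𝟙_ C) Y ≫ _ ◁ (T.map f ≫ D.κ) ≫ (ρ_ _).hom := by
  have h := T.η.naturality f
  simp only [Functor.id_map] at h
  rw [proj', ν', reassoc_of% h, ← T.toFunctor.map_comp_assoc, leftUnitor_inv_naturality,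
    Functor.map_comp_assoc, reassoc_of% (D.t2_natural_right (𝟙_ C) f)]
  simp

/-- The idempotent `proj` identifies whatever cannot be told apart by `κ`. -/
theorem proj_congr {Y : C} {f g : Y ⟶ T.obj (𝟙_ C)} (h : T.map f ≫ D.κ = T.map g ≫ D.κ) :
    f ≫ D.proj = g ≫ D.proj := by
  rw [comp_proj, comp_proj, h]

theorem proj_proj : D.proj ≫ D.proj = D.proj := by
  have := D.proj_congr (f := D.proj) (g := 𝟙 _) (by rw [map_proj_κ]; simp)
  rwa [Category.id_comp] at this

theorem proj'_proj : D.proj' ≫ D.proj = D.proj := by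
  have := D.proj_congr (f := D.proj') (g := 𝟙 _) (by rw [map_proj'_κ]; simp)
  rwa [Category.id_comp] at this

theorem proj_t0 : D.proj ≫ D.t0 = D.t0 := by
  have h := T.η.naturality D.proj
  simp only [Functor.id_map] at h
  have h₂ : T.η.app _ ≫ D.κ = D.t0 := T.left_unit_assoc _ _
  have h₃ := congrArg (fun k => T.η.app _ ≫ k) D.map_proj_κ
  rwa [← reassoc_of% h, h₂] at h₃

theorem map_proj_mul_proj :
    T.map D.proj ≫ T.μ.app _ ≫ D.proj = T.μ.app _ ≫ D.proj := by
  rw [← Category.assoc]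
  apply proj_congr
  have h := T.μ.naturality D.proj
  simp only [Functor.comp_map] at h
  rw [Functor.map_comp, Category.assoc, map_μ_κ, reassoc_of% h, map_proj_κ]

/-- A unit object among the algebras: the image of `proj` as a quotient `p` of the free algebra on
the unit object of the base category, with a section `s` of the underlying morphism and a morphism
`counit` through which `t0` factors. The condition `proj'_p` makes the notion invariant under
reversal of the tensor product. -/
structure UnitAlgebra where
  alg : T.Algebra
  p : T.obj (𝟙_ C) ⟶ alg.A
  p_a : T.map p ≫ alg.a = T.μ.app (𝟙_ C) ≫ p
  s : alg.A ⟶ T.obj (𝟙_ C)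
  counit : alg.A ⟶ 𝟙_ C
  s_p : s ≫ p = 𝟙 _
  proj_p : D.proj ≫ p = p
  proj'_p : D.proj' ≫ p = p
  p_counit : p ≫ counit = D.t0

/-- Splitting `proj` yields a unit algebra: the multiplication of the free algebra passes to the
quotient by `map_proj_mul_proj`, the counit by `proj_t0`. -/
theorem exists_unitAlgebra [IsIdempotentComplete C] : Nonempty D.UnitAlgebra := by
  obtain ⟨Z, s, p, hsp, hps⟩ := IsIdempotentComplete.idempotents_split _ _ D.proj_proj
  have hp : D.proj ≫ p = p := by rw [← hps, Category.assoc, hsp, Category.comp_id]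
  have hm : T.map D.proj ≫ T.μ.app _ ≫ p = T.μ.app _ ≫ p := by
    have := congrArg (fun k => k ≫ p) D.map_proj_mul_proj
    simpa only [Category.assoc, hp] using this
  have h₁ := T.η.naturality s
  have h₂ := T.μ.naturality s
  simp only [Functor.id_map, Functor.comp_map] at h₁ h₂
  refine ⟨⟨⟨Z, T.map s ≫ T.μ.app _ ≫ p, ?_, ?_⟩, p, ?_, s, s ≫ D.t0, hsp, hp, ?_, ?_⟩⟩
  · rw [← reassoc_of% h₁, ← hsp]
    exact congrArg (fun k => s ≫ k) (T.left_unit_assoc _ _)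
  · simp only [Functor.map_comp, Category.assoc]
    rw [← reassoc_of% h₂, ← reassoc_of% (T.assoc (𝟙_ C)), ← T.toFunctor.map_comp_assoc p s, hps, hm]
  · change T.map p ≫ T.map s ≫ T.μ.app _ ≫ p = T.μ.app _ ≫ p
    rw [← T.toFunctor.map_comp_assoc, hps, hm]
  · change D.proj' ≫ p = p
    rw [← hp, ← Category.assoc, proj'_proj]
  · change p ≫ s ≫ D.t0 = D.t0
    rw [reassoc_of% hps, proj_t0]

/-- For a weak bialgebra, `y ⊗ (x ⊗ v) ↦ ε(y₁ x) y₂ ⊗ v`. -/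
def σ (X : C) : T.obj (T.obj (𝟙_ C) ⊗ X) ⟶ T.obj X :=
  D.t2 (T.obj (𝟙_ C)) X ≫ D.κ ▷ T.obj X ≫ (λ_ _).hom

/-- The action of the image of `proj` on an algebra: for a weak bialgebra, `x ⊗ v ↦ ε(1₁ x) 1₂ v`. -/
def θ (X : T.Algebra) : T.obj (𝟙_ C) ⊗ X.A ⟶ X.A := T.η.app _ ≫ D.σ X.A ≫ X.a

/-- Since `t2` is counital, the multiplication can be recovered from its compatibility with `t2`. -/
theorem μ_eq (X : C) : T.μ.app X = T.map (T.map (λ_ X).inv) ≫ T.map (D.t2 (𝟙_ C) X) ≫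
    D.t2 (T.obj (𝟙_ C)) (T.obj X) ≫ (D.κ ⊗ₘ T.μ.app X) ≫ (λ_ _).hom := by
  have h := T.μ.naturality (λ_ X).inv
  simp only [Functor.comp_map] at h
  have e : (D.κ ⊗ₘ T.μ.app X) = (T.μ.app _ ⊗ₘ T.μ.app X) ≫ (D.t0 ⊗ₘ 𝟙 _) := by
    simp only [κ, tensorHom_comp_tensorHom, Category.comp_id]
  rw [e, Category.assoc, ← reassoc_of% (D.mul_t2 (𝟙_ C) X), D.counit_left, reassoc_of% h,
    ← T.toFunctor.map_comp]
  simp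

theorem η_σ_t2 (X : C) : T.η.app _ ≫ D.σ X ≫ T.map (λ_ X).inv ≫ D.t2 (𝟙_ C) X =
    T.η.app _ ≫ D.t2 (T.obj (𝟙_ C)) X ≫ D.ν ▷ T.obj X := by
  have h := D.coassoc (T.obj (𝟙_ C)) (𝟙_ C) X
  have e : D.ν ▷ T.obj X = T.map (ρ_ _).inv ▷ _ ≫ (D.t2 (T.obj (𝟙_ C)) (𝟙_ C) ⊗ₘ 𝟙 _) ≫
      (α_ _ _ _).hom ≫ D.κ ▷ _ ≫ (λ_ _).hom := by
    simp [ν]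
  rw [e, ← reassoc_of% (D.t2_natural_left (ρ_ (T.obj (𝟙_ C))).inv X), reassoc_of% h,
    ← T.toFunctor.map_comp_assoc, σ]
  have e₂ : (ρ_ (T.obj (𝟙_ C))).inv ▷ X ≫ (α_ _ _ _).hom = _ ◁ (λ_ X).inv := by
    monoidal
  rw [e₂, reassoc_of% (D.t2_natural_right (T.obj (𝟙_ C)) (λ_ X).inv)]
  simp only [id_tensorHom, Category.assoc, whisker_exchange_assoc,
    MonoidalCategory.leftUnitor_naturality, MonoidalCategory.leftUnitor_naturality_assoc]

/-- For a weak bialgebra, `y ε(1₁ x) 1₂ = ε(y₁ x) y₂`. The weak multiplicativity `counit_mul_left`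
enters through `map_ν_κ`. -/
theorem map_η_σ (X : C) : T.map (T.η.app _ ≫ D.σ X) ≫ T.μ.app X = D.σ X := by
  have h : T.map (T.η.app _ ≫ D.σ X) ≫ T.map (T.map (λ_ X).inv) ≫ T.map (D.t2 (𝟙_ C) X) =
    T.map (T.η.app _) ≫ T.map (D.t2 (T.obj (𝟙_ C)) X) ≫ T.map (D.ν ▷ T.obj X) := by
    simp only [← Functor.map_comp, Category.assoc, η_σ_t2]
  have e : T.map D.ν ▷ T.obj (T.obj X) ≫ (D.κ ⊗ₘ T.μ.app X) =
      (T.μ.app _ ⊗ₘ T.μ.app X) ≫ D.κ ▷ T.obj X := by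
    simp only [← tensorHom_id, tensorHom_comp_tensorHom, map_ν_κ, map_μ_κ, Category.comp_id,
      Category.id_comp]
  rw [D.μ_eq, reassoc_of% h, reassoc_of% (D.t2_natural_left D.ν (T.obj X)), reassoc_of% e,
    ← reassoc_of% (D.mul_t2 (T.obj (𝟙_ C)) X), T.right_unit_assoc, σ]

theorem map_θ_a (X : T.Algebra) : T.map (D.θ X) ≫ X.a = D.σ X.A ≫ X.a := by
  have e : D.θ X = (T.η.app _ ≫ D.σ X.A) ≫ X.a := by rw [θ, Category.assoc]
  rw [e, Functor.map_comp, Category.assoc, ← X.assoc, ← Category.assoc, map_η_σ]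

end Unit
/-! ### The left unitor -/

section LeftUnitor
variable {C : Type u} [Category.{v} C] [MonoidalCategory C] {T : Monad C} {D : WeakOpmonoidal T}

/-- The action on the product of the free algebra on the unit object with an algebra. -/
def freeAct (D : WeakOpmonoidal T) (X : T.Algebra) :
    T.obj (T.obj (𝟙_ C) ⊗ X.A) ⟶ T.obj (𝟙_ C) ⊗ X.A :=
  D.t2 (T.obj (𝟙_ C)) X.A ≫ (T.μ.app (𝟙_ C) ⊗ₘ X.a)

theorem freeAct_t0 (D : WeakOpmonoidal T) (X : T.Algebra) :
    D.freeAct X ≫ D.t0 ▷ X.A ≫ (λ_ _).hom = D.σ X.A ≫ X.a := by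
  have e : (T.μ.app (𝟙_ C) ⊗ₘ X.a) ≫ D.t0 ▷ X.A = D.κ ▷ _ ≫ _ ◁ X.a := by
    simp only [κ, ← tensorHom_id, ← id_tensorHom, tensorHom_comp_tensorHom, Category.comp_id,
      Category.id_comp]
  rw [freeAct, Category.assoc, reassoc_of% e, σ]
  simp only [Category.assoc, MonoidalCategory.leftUnitor_naturality]

/-- The idempotent on the product of the free algebra on the unit object with an algebra. -/
def freeIdem (D : WeakOpmonoidal T) (X : T.Algebra) : T.obj (𝟙_ C) ⊗ X.A ⟶ T.obj (𝟙_ C) ⊗ X.A :=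
  T.η.app _ ≫ D.freeAct X

theorem freeIdem_t0 (D : WeakOpmonoidal T) (X : T.Algebra) :
    D.freeIdem X ≫ D.t0 ▷ X.A ≫ (λ_ _).hom = D.θ X := by
  rw [freeIdem, Category.assoc, freeAct_t0, θ]

theorem freeAct_freeIdem (D : WeakOpmonoidal T) (X : T.Algebra) :
    D.freeAct X ≫ D.freeIdem X = D.freeAct X :=
  D.act_idem (T.free.obj (𝟙_ C)) X

theorem freeAct_θ (D : WeakOpmonoidal T) (X : T.Algebra) :
    D.freeAct X ≫ D.θ X = D.σ X.A ≫ X.a := by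
  rw [← freeIdem_t0, reassoc_of% (D.freeAct_freeIdem X), freeAct_t0]

/-- The unit element acts as the identity. -/
theorem unit_θ (D : WeakOpmonoidal T) (X : T.Algebra) :
    (λ_ X.A).inv ≫ T.η.app (𝟙_ C) ▷ X.A ≫ D.θ X = 𝟙 _ := by
  have h := T.η.naturality (T.η.app (𝟙_ C) ▷ X.A)
  have h₂ := T.η.naturality (λ_ X.A).hom
  simp only [Functor.id_map] at h h₂
  have e : T.map (T.η.app (𝟙_ C)) ≫ D.κ = D.t0 := T.right_unit_assoc _ _
  have hc := D.counit_left X.A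
  rw [tensorHom_id] at hc
  rw [θ, σ]
  simp only [Category.assoc]
  rw [reassoc_of% h, reassoc_of% (D.t2_natural_left (T.η.app (𝟙_ C)) X.A),
    ← comp_whiskerRight_assoc, e, reassoc_of% hc, ← reassoc_of% h₂, X.unit]
  simp

theorem mul_proj' (D : WeakOpmonoidal T) : T.μ.app (𝟙_ C) ≫ D.proj' =
    (λ_ _).inv ≫ (T.η.app _ ≫ D.t2 (𝟙_ C) (T.obj (T.obj (𝟙_ C))) ≫ _ ◁ T.μ.app _) ≫
      _ ◁ D.κ ≫ (ρ_ _).hom := by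
  have h := T.η.naturality (λ_ (T.obj (T.obj (𝟙_ C)))).inv
  simp only [Functor.id_map] at h
  rw [comp_proj', map_μ_κ]
  simp only [Functor.comp_obj]
  rw [← reassoc_of% h]
  simp

/-- Acting by `θ` and then inserting a unit element into the product is, after the idempotent, the
same as applying `proj'` to the first factor. This is what makes the left unitor injective. -/
theorem θ_unit_idem (D : WeakOpmonoidal T) (X : T.Algebra) :
    D.θ X ≫ (λ_ X.A).inv ≫ T.η.app (𝟙_ C) ▷ X.A ≫ D.freeIdem X =
      D.freeIdem X ≫ D.proj' ▷ X.A := by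
  have hU := D.unit_left (𝟙_ C) (T.obj (𝟙_ C)) X.A
  have h₁ := T.η.naturality (T.η.app (𝟙_ C) ▷ X.A)
  have h₂ := T.η.naturality (𝟙_ C ◁ D.θ X)
  simp only [Functor.id_map, Functor.id_obj] at h₁ h₂
  have e₁ : T.map (T.η.app (𝟙_ C)) ▷ T.obj X.A ≫ (T.μ.app (𝟙_ C) ⊗ₘ X.a) =
      T.obj (𝟙_ C) ◁ X.a := by
    rw [← tensorHom_id, tensorHom_comp_tensorHom, T.right_unit, Category.id_comp]
    exact id_tensorHom _ _
  have l : D.θ X ≫ (λ_ X.A).inv ≫ T.η.app (𝟙_ C) ▷ X.A ≫ D.freeIdem X =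
      (λ_ _).inv ≫ T.η.app _ ≫ D.t2 (𝟙_ C) (T.obj (𝟙_ C) ⊗ X.A) ≫ _ ◁ (D.σ X.A ≫ X.a) := by
    rw [freeIdem, freeAct, reassoc_of% h₁, reassoc_of% (D.t2_natural_left (T.η.app (𝟙_ C)) X.A), e₁,
      leftUnitor_inv_naturality_assoc, reassoc_of% h₂,
      reassoc_of% (D.t2_natural_right (𝟙_ C) (D.θ X)), ← MonoidalCategory.whiskerLeft_comp, map_θ_a]
  have e₂ : (T.μ.app (𝟙_ C) ⊗ₘ X.a) ≫ D.proj' ▷ X.A =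
      (T.μ.app (𝟙_ C) ≫ D.proj') ▷ _ ≫ _ ◁ X.a := by
    simp only [← tensorHom_id, ← id_tensorHom, tensorHom_comp_tensorHom, Category.comp_id,
      Category.id_comp]
  rw [l, freeIdem, freeAct, Category.assoc, Category.assoc, e₂, mul_proj', σ]
  simp only [id_tensorHom, tensorHom_id] at hU
  simp only [MonoidalCategory.whiskerLeft_comp, Category.assoc]
  rw [reassoc_of% hU]
  simp only [comp_whiskerRight, MonoidalCategory.whiskerLeft_comp, Category.assoc]
  monoidal

variable (U : D.UnitAlgebra) (X : T.Algebra)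

theorem freeAct_natural : T.map (U.p ▷ X.A) ≫ D.act U.alg X = D.freeAct X ≫ U.p ▷ X.A := by
  have h := D.act_natural (X := T.free.obj (𝟙_ C)) ⟨U.p, U.p_a⟩ (𝟙 X)
  rwa [Monad.Algebra.id_f, tensorHom_id] at h

theorem freeIdem_natural : U.p ▷ X.A ≫ D.idem U.alg X = D.freeIdem X ≫ U.p ▷ X.A := by
  have h := D.idem_natural (X := T.free.obj (𝟙_ C)) ⟨U.p, U.p_a⟩ (𝟙 X)
  rwa [Monad.Algebra.id_f, tensorHom_id] at h

variable [IsIdempotentComplete C]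

theorem whiskerRight_p_π :
    U.p ▷ X.A ≫ D.π U.alg X = D.freeIdem X ≫ U.p ▷ X.A ≫ D.π U.alg X := by
  have h := freeIdem_natural U X
  rw [← reassoc_of% h, idem_π]

theorem section_p_π : (D.ι U.alg X ≫ U.s ▷ X.A) ≫ U.p ▷ X.A ≫ D.π U.alg X = 𝟙 _ := by
  rw [Category.assoc, ← comp_whiskerRight_assoc, U.s_p]
  simp [ι_π]

/-- The morphism underlying the left unitor of algebras. -/
noncomputable def leftUnit : (D.tensor U.alg X).A ⟶ X.A :=
  D.ι U.alg X ≫ U.counit ▷ X.A ≫ (λ_ _).hom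

/-- On the quotient map `TK ⊗ X ⟶ U ⊗ X`, the left unitor is the action `θ`. -/
theorem p_π_leftUnit : U.p ▷ X.A ≫ D.π U.alg X ≫ leftUnit U X = D.θ X := by
  have h := freeIdem_natural U X
  rw [leftUnit, reassoc_of% (D.π_ι U.alg X), reassoc_of% h, ← comp_whiskerRight_assoc, U.p_counit,
    freeIdem_t0]

theorem map_leftUnit_a : T.map (leftUnit U X) ≫ X.a = (D.tensor U.alg X).a ≫ leftUnit U X := by
  have h : T.map (U.p ▷ X.A ≫ D.π U.alg X) ≫ (D.tensor U.alg X).a =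
      D.freeAct X ≫ U.p ▷ X.A ≫ D.π U.alg X := by
    have h₁ := freeAct_natural U X
    rw [Functor.map_comp, Category.assoc, map_π_a, reassoc_of% h₁]
  have h₂ : T.map (U.p ▷ X.A ≫ D.π U.alg X) ≫ T.map (leftUnit U X) ≫ X.a =
      T.map (U.p ▷ X.A ≫ D.π U.alg X) ≫ (D.tensor U.alg X).a ≫ leftUnit U X := by
    rw [reassoc_of% h, p_π_leftUnit, freeAct_θ, ← T.toFunctor.map_comp_assoc, Category.assoc,
      p_π_leftUnit, map_θ_a]
  -- `T` preserves the section of `U.p ▷ X.A ≫ D.π U.alg X`, so this morphism can be cancelled.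
  have h₃ := congrArg (fun k => T.map (D.ι U.alg X ≫ U.s ▷ X.A) ≫ k) h₂
  have h₄ : T.map (D.ι U.alg X ≫ U.s ▷ X.A) ≫ T.map (U.p ▷ X.A ≫ D.π U.alg X) = 𝟙 _ := by
    rw [← Functor.map_comp, section_p_π, T.toFunctor.map_id]
  rwa [reassoc_of% h₄, reassoc_of% h₄] at h₃

theorem leftUnit_inv : leftUnit U X ≫ (λ_ X.A).inv ≫ (T.η.app (𝟙_ C) ≫ U.p) ▷ X.A ≫
    D.π U.alg X = 𝟙 _ := by
  have h : (U.p ▷ X.A ≫ D.π U.alg X) ≫ leftUnit U X ≫ (λ_ X.A).inv ≫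
      (T.η.app (𝟙_ C) ≫ U.p) ▷ X.A ≫ D.π U.alg X = U.p ▷ X.A ≫ D.π U.alg X := by
    rw [Category.assoc, reassoc_of% (p_π_leftUnit U X), comp_whiskerRight, Category.assoc,
      whiskerRight_p_π, reassoc_of% (D.θ_unit_idem X), ← comp_whiskerRight_assoc, U.proj'_p]
  have h₃ := congrArg (fun k => (D.ι U.alg X ≫ U.s ▷ X.A) ≫ k) h
  rw [section_p_π] at h₃
  rw [← h₃, ← Category.assoc _ _ (leftUnit U X ≫ _), section_p_π, Category.id_comp]

theorem inv_leftUnit : ((λ_ X.A).inv ≫ (T.η.app (𝟙_ C) ≫ U.p) ▷ X.A ≫ D.π U.alg X) ≫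
    leftUnit U X = 𝟙 _ := by
  simp only [comp_whiskerRight, Category.assoc]
  rw [p_π_leftUnit, unit_θ]

end LeftUnitor
end WeakOpmonoidal

/-! ### Reversal of the tensor product, and the right unitor -/

section Reverse

/-- The monoidal structure with the factors of every product interchanged. -/
abbrev revMonoidal (C : Type u) [Category.{v} C] [MonoidalCategory C] : MonoidalCategory C where
  tensorObj X Y := Y ⊗ X
  whiskerLeft X _ _ f := f ▷ X
  whiskerRight f X := X ◁ f
  tensorHom f g := g ⊗ₘ f
  tensorHom_def f g := MonoidalCategory.tensorHom_def' g f
  id_tensorHom_id X Y := id_tensorHom_id Y X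
  tensorHom_comp_tensorHom f g h k := tensorHom_comp_tensorHom g f k h
  whiskerLeft_id X Y := id_whiskerRight Y X
  id_whiskerRight X Y := MonoidalCategory.whiskerLeft_id Y X
  tensorUnit := 𝟙_ C
  associator X Y Z := (α_ Z Y X).symm
  leftUnitor X := ρ_ X
  rightUnitor X := λ_ X
  associator_naturality f g h := associator_inv_naturality h g f
  leftUnitor_naturality f := MonoidalCategory.rightUnitor_naturality f
  rightUnitor_naturality f := MonoidalCategory.leftUnitor_naturality f
  pentagon W X Y Z := pentagon_inv (W := Z) (X := Y) (Y := X) (Z := W)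
  triangle X Y := by
    change (α_ Y (𝟙_ C) X).inv ≫ (ρ_ Y).hom ▷ X = Y ◁ (λ_ X).hom
    simp

namespace WeakOpmonoidal
variable {C : Type u} [Category.{v} C] [MonoidalCategory C] {T : Monad C} (D : WeakOpmonoidal T)

theorem coassoc_inv (X Y Z : C) :
    D.t2 X (Y ⊗ Z) ≫ (𝟙 (T.obj X) ⊗ₘ D.t2 Y Z) ≫ (α_ _ _ _).inv =
      T.map (α_ X Y Z).inv ≫ D.t2 (X ⊗ Y) Z ≫ (D.t2 X Y ⊗ₘ 𝟙 (T.obj Z)) := by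
  rw [← cancel_mono (α_ _ _ _).hom, Category.assoc, Category.assoc, Category.assoc,
    Category.assoc, D.coassoc, ← T.toFunctor.map_comp_assoc]
  simp

/-- The same structure for the reversed tensor product. -/
def rev : @WeakOpmonoidal C _ (revMonoidal C) T :=
  @WeakOpmonoidal.mk C _ (revMonoidal C) T (fun X Y => D.t2 Y X) D.t0 (fun f g => D.natural g f)
    (fun X Y Z => D.coassoc_inv Z Y X) D.counit_right D.counit_left (fun X Y => D.mul_t2 Y X)
    (fun X Y Z => D.unit_right Z Y X) (fun X Y Z => D.unit_left Z Y X)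
    D.counit_mul_right D.counit_mul_left

variable {D}

/-- The same unit algebra for the reversed tensor product. -/
def UnitAlgebra.rev (U : D.UnitAlgebra) : @UnitAlgebra C _ (revMonoidal C) T D.rev :=
  @UnitAlgebra.mk C _ (revMonoidal C) T D.rev U.alg U.p U.p_a U.s U.counit U.s_p U.proj'_p U.proj_p
    U.p_counit

variable [IsIdempotentComplete C] (U : D.UnitAlgebra) (X : T.Algebra)

/-- The morphism underlying the right unitor of algebras, which is `leftUnit` for the reversed tensor
product. -/
noncomputable def rightUnit : (D.tensor X U.alg).A ⟶ X.A :=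
  D.ι X U.alg ≫ X.A ◁ U.counit ≫ (ρ_ _).hom

theorem map_rightUnit_a : T.map (rightUnit U X) ≫ X.a = (D.tensor X U.alg).a ≫ rightUnit U X :=
  @map_leftUnit_a C _ (revMonoidal C) T D.rev U.rev X _

theorem rightUnit_inv : rightUnit U X ≫ (ρ_ X.A).inv ≫ X.A ◁ (T.η.app (𝟙_ C) ≫ U.p) ≫
    D.π X U.alg = 𝟙 _ :=
  @leftUnit_inv C _ (revMonoidal C) T D.rev U.rev X _

theorem inv_rightUnit : ((ρ_ X.A).inv ≫ X.A ◁ (T.η.app (𝟙_ C) ≫ U.p) ≫ D.π X U.alg) ≫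
    rightUnit U X = 𝟙 _ :=
  @inv_leftUnit C _ (revMonoidal C) T D.rev U.rev X _

end WeakOpmonoidal
end Reverse

/-! ### The monoidal category of algebras and its forgetful functor -/

namespace WeakOpmonoidal
section WeakBimonad
variable {C : Type u} [Category.{v} C] [MonoidalCategory C] [IsIdempotentComplete C] {T : Monad C}
  (D : WeakOpmonoidal T)

theorem tensorMap_id (X Y : T.Algebra) : D.tensorMap (𝟙 X) (𝟙 Y) = 𝟙 _ := by
  ext
  apply cancel_ι
  rw [tensorMap_ι]
  simp

theorem tensorMap_comp {X₁ X₂ X₃ Y₁ Y₂ Y₃ : T.Algebra} (f₁ : X₁ ⟶ X₂) (f₂ : X₂ ⟶ X₃)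
    (g₁ : Y₁ ⟶ Y₂) (g₂ : Y₂ ⟶ Y₃) :
    D.tensorMap f₁ g₁ ≫ D.tensorMap f₂ g₂ = D.tensorMap (f₁ ≫ f₂) (g₁ ≫ g₂) := by
  ext
  apply cancel_ι
  rw [tensorMap_ι, Monad.Algebra.comp_f, Category.assoc, tensorMap_ι,
    reassoc_of% (D.tensorMap_ι f₁ g₁)]
  simp

theorem tensorMap_id_ι {X X' : T.Algebra} (f : X ⟶ X') (Y : T.Algebra) :
    (D.tensorMap f (𝟙 Y)).f ≫ D.ι X' Y = D.ι X Y ≫ f.f ▷ Y.A := by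
  rw [tensorMap_ι, Monad.Algebra.id_f, tensorHom_id]

theorem id_tensorMap_ι {X X' : T.Algebra} (f : X ⟶ X') (Y : T.Algebra) :
    (D.tensorMap (𝟙 Y) f).f ≫ D.ι Y X' = D.ι Y X ≫ Y.A ◁ f.f := by
  rw [tensorMap_ι, Monad.Algebra.id_f, id_tensorHom]

theorem assoc_hom_ι_ι (X Y Z : T.Algebra) :
    (D.assoc X Y Z).hom.f ≫ D.ι X (D.tensor Y Z) ≫ X.A ◁ D.ι Y Z =
      D.ι (D.tensor X Y) Z ≫ D.ι X Y ▷ Z.A ≫ (α_ _ _ _).hom := by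
  have h := D.assoc_hom_ι X Y Z
  rwa [ιLeft, ιRight, Category.assoc] at h

theorem assoc_naturality {X X' Y Y' Z Z' : T.Algebra} (f : X ⟶ X') (g : Y ⟶ Y') (h : Z ⟶ Z') :
    D.tensorMap (D.tensorMap f g) h ≫ (D.assoc X' Y' Z').hom =
      (D.assoc X Y Z).hom ≫ D.tensorMap f (D.tensorMap g h) := by
  ext
  apply cancel_ιRight
  simp only [Monad.Algebra.comp_f, Category.assoc]
  have e₁ : ((D.tensorMap f g).f ⊗ₘ h.f) ≫ D.ι X' Y' ▷ Z'.A =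
      D.ι X Y ▷ Z.A ≫ ((f.f ⊗ₘ g.f) ⊗ₘ h.f) := by
    simp only [← tensorHom_id, tensorHom_comp_tensorHom, tensorMap_ι, Category.comp_id,
      Category.id_comp]
  have e₂ : (f.f ⊗ₘ (D.tensorMap g h).f) ≫ X'.A ◁ D.ι Y' Z' =
      X.A ◁ D.ι Y Z ≫ (f.f ⊗ₘ (g.f ⊗ₘ h.f)) := by
    simp only [← id_tensorHom, tensorHom_comp_tensorHom, tensorMap_ι, Category.comp_id,
      Category.id_comp]
  rw [assoc_hom_ι, ιLeft, ιRight, Category.assoc,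
    reassoc_of% (D.tensorMap_ι (D.tensorMap f g) h), reassoc_of% e₁,
    reassoc_of% (D.tensorMap_ι f (D.tensorMap g h)), e₂, reassoc_of% (D.assoc_hom_ι_ι X Y Z),
    associator_naturality]

theorem assoc_pentagon (W X Y Z : T.Algebra) :
    D.tensorMap (D.assoc W X Y).hom (𝟙 Z) ≫ (D.assoc W (D.tensor X Y) Z).hom ≫
        D.tensorMap (𝟙 W) (D.assoc X Y Z).hom =
      (D.assoc (D.tensor W X) Y Z).hom ≫ (D.assoc W X (D.tensor Y Z)).hom := by
  ext
  apply cancel_ι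
  have hm : Mono (W.A ◁ D.ιRight X Y Z) := by
    have : W.A ◁ D.ιRight X Y Z ≫ W.A ◁ D.πRight X Y Z = 𝟙 _ := by
      rw [← MonoidalCategory.whiskerLeft_comp, ιRight_πRight, MonoidalCategory.whiskerLeft_id]
    exact mono_of_mono_fac this
  rw [← cancel_mono (W.A ◁ D.ιRight X Y Z)]
  simp only [Monad.Algebra.comp_f, Category.assoc]
  rw [reassoc_of% (D.id_tensorMap_ι (D.assoc X Y Z).hom W), ← MonoidalCategory.whiskerLeft_comp,
    assoc_hom_ι, ιLeft, ιRight]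
  simp only [MonoidalCategory.whiskerLeft_comp, Category.assoc]
  rw [reassoc_of% (D.assoc_hom_ι_ι W (D.tensor X Y) Z),
    reassoc_of% (D.assoc_hom_ι_ι W X (D.tensor Y Z)),
    reassoc_of% (D.tensorMap_id_ι (D.assoc W X Y).hom Z),
    ← associator_naturality_middle_assoc, ← comp_whiskerRight_assoc, ← comp_whiskerRight_assoc,
    Category.assoc, assoc_hom_ι_ι, ← associator_naturality_right, ← whisker_exchange_assoc,
    reassoc_of% (D.assoc_hom_ι_ι (D.tensor W X) Y Z)]
  simp

theorem idem_whiskerRight_ι (X Y Z : T.Algebra) :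
    D.idem (D.tensor X Y) Z ≫ D.ι X Y ▷ Z.A = D.ι X Y ▷ Z.A ≫ T.η.app _ ≫ D.actLeft X Y Z := by
  have h := T.η.naturality (D.ι X Y ▷ Z.A)
  simp only [Functor.id_map] at h
  rw [reassoc_of% h, map_whiskerRight_ι_actLeft, idem, Category.assoc]

theorem whiskerLeft_π_idem (X Y Z : T.Algebra) :
    X.A ◁ D.π Y Z ≫ D.idem X (D.tensor Y Z) = T.η.app _ ≫ D.actRight X Y Z ≫ X.A ◁ D.π Y Z := by
  have h := T.η.naturality (X.A ◁ D.π Y Z)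
  simp only [Functor.id_map] at h
  have e : T.map (X.A ◁ D.π Y Z) ≫ D.act X (D.tensor Y Z) = D.actRight X Y Z ≫ X.A ◁ D.π Y Z := by
    conv_lhs => rw [act]
    rw [actRight, reassoc_of% (D.t2_natural_right X.A (D.π Y Z))]
    simp only [← id_tensorHom, Category.assoc, tensorHom_comp_tensorHom, Category.comp_id,
      Category.id_comp, D.map_π_a]
  rw [idem, reassoc_of% h, e]

/-- The Frobenius condition: after the idempotent on the whole threefold product is written as the
composite of the two partial ones by `η_actLeft`, both of these are absorbed by `ι` and `π`. -/
theorem frobenius_left (X Y Z : T.Algebra) :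
    D.ι X Y ▷ Z.A ≫ (α_ _ _ _).hom ≫ X.A ◁ D.π Y Z =
      D.π (D.tensor X Y) Z ≫ (D.assoc X Y Z).hom.f ≫ D.ι X (D.tensor Y Z) := by
  have e₁ : D.ι X Y ▷ Z.A ≫ D.πLeft X Y Z ≫ D.ιLeft X Y Z ≫ (α_ _ _ _).hom ≫ X.A ◁ D.π Y Z =
      D.ι X Y ▷ Z.A ≫ (α_ _ _ _).hom ≫ X.A ◁ D.π Y Z := by
    rw [reassoc_of% (D.πLeft_ιLeft X Y Z), reassoc_of% (D.η_actLeft X Y Z), Iso.inv_hom_id_assoc,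
      ← MonoidalCategory.whiskerLeft_comp, idem_π, ← comp_whiskerRight_assoc, ι_idem]
  rw [assoc_hom_f, Category.assoc, Category.assoc, πRight, Category.assoc, π_ι,
    whiskerLeft_π_idem, ← reassoc_of% (D.πRight_ιRight X Y Z),
    ← reassoc_of% (D.πLeft_ιLeft_associator X Y Z)]
  conv_rhs => rw [ιLeft, Category.assoc, reassoc_of% (D.π_ι (D.tensor X Y) Z),
    reassoc_of% (D.idem_whiskerRight_ι X Y Z), ← reassoc_of% (D.πLeft_ιLeft X Y Z),
    reassoc_of% (D.ιLeft_πLeft X Y Z)]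
  exact e₁.symm

/-- The algebra morphism out of a free algebra with adjunct `f ≫ π`, followed by `ι`, forgets the
idempotent. -/
theorem map_comp_π_a_ι {W : C} {X Y : T.Algebra} (f : W ⟶ X.A ⊗ Y.A) :
    T.map (f ≫ D.π X Y) ≫ (D.tensor X Y).a ≫ D.ι X Y = T.map f ≫ D.act X Y := by
  rw [Functor.map_comp, Category.assoc, reassoc_of% (D.map_π_a X Y), π_ι, act_idem]

variable {D} (U : D.UnitAlgebra)

/-- The left unitor of algebras. -/
noncomputable def leftUnitorAlg (X : T.Algebra) : D.tensor U.alg X ≅ X :=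
  Monad.Algebra.isoMk ⟨leftUnit U X, _, leftUnit_inv U X, inv_leftUnit U X⟩ (map_leftUnit_a U X)

/-- The right unitor of algebras. -/
noncomputable def rightUnitorAlg (X : T.Algebra) : D.tensor X U.alg ≅ X :=
  Monad.Algebra.isoMk ⟨rightUnit U X, _, rightUnit_inv U X, inv_rightUnit U X⟩ (map_rightUnit_a U X)

theorem leftUnitorAlg_naturality {X Y : T.Algebra} (f : X ⟶ Y) :
    D.tensorMap (𝟙 U.alg) f ≫ (leftUnitorAlg U Y).hom = (leftUnitorAlg U X).hom ≫ f := by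
  ext
  change (D.tensorMap (𝟙 U.alg) f).f ≫ leftUnit U Y = leftUnit U X ≫ f.f
  rw [leftUnit, leftUnit, reassoc_of% (D.id_tensorMap_ι f U.alg)]
  simp [whisker_exchange_assoc]

theorem rightUnitorAlg_naturality {X Y : T.Algebra} (f : X ⟶ Y) :
    D.tensorMap f (𝟙 U.alg) ≫ (rightUnitorAlg U Y).hom = (rightUnitorAlg U X).hom ≫ f := by
  ext
  change (D.tensorMap f (𝟙 U.alg)).f ≫ rightUnit U Y = rightUnit U X ≫ f.f
  rw [rightUnit, rightUnit, reassoc_of% (D.tensorMap_id_ι f U.alg)]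
  simp [← whisker_exchange_assoc]

theorem unitor_triangle (X Y : T.Algebra) :
    (D.assoc X U.alg Y).hom ≫ D.tensorMap (𝟙 X) (leftUnitorAlg U Y).hom =
      D.tensorMap (rightUnitorAlg U X).hom (𝟙 Y) := by
  ext
  apply cancel_ι
  have h₁ := D.id_tensorMap_ι (leftUnitorAlg U Y).hom X
  have h₂ := D.tensorMap_id_ι (rightUnitorAlg U X).hom Y
  change _ = _ ≫ X.A ◁ leftUnit U Y at h₁
  change _ = _ ≫ rightUnit U X ▷ Y.A at h₂
  rw [Monad.Algebra.comp_f, Category.assoc, h₁, h₂, leftUnit, rightUnit]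
  simp only [MonoidalCategory.whiskerLeft_comp]
  rw [reassoc_of% (D.assoc_hom_ι_ι X U.alg Y)]
  simp

/-- The tensor product, the unit and the structural isomorphisms of algebras. -/
noncomputable abbrev monoidalStruct : MonoidalCategoryStruct T.Algebra where
  tensorObj := D.tensor
  whiskerLeft X _ _ f := D.tensorMap (𝟙 X) f
  whiskerRight f Y := D.tensorMap f (𝟙 Y)
  tensorHom f g := D.tensorMap f g
  tensorUnit := U.alg
  associator := D.assoc
  leftUnitor := leftUnitorAlg U
  rightUnitor := rightUnitorAlg U

/-- The monoidal structure on the category of algebras. -/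
noncomputable abbrev monoidal : MonoidalCategory T.Algebra :=
  @MonoidalCategory.ofTensorHom _ _ (monoidalStruct U) D.tensorMap_id (fun _ _ _ _ => rfl)
    (fun _ _ => rfl) (fun f₁ f₂ g₁ g₂ => D.tensorMap_comp f₁ g₁ f₂ g₂)
    (fun f g h => D.assoc_naturality f g h) (leftUnitorAlg_naturality U)
    (rightUnitorAlg_naturality U) D.assoc_pentagon (unitor_triangle U)

/-- The forgetful functor is monoidal by means of the projections `π`. -/
noncomputable abbrev forgetLax : @Functor.LaxMonoidal _ _ (monoidal U) C _ _ T.forget :=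
  letI := monoidal U
  { ε := T.η.app (𝟙_ C) ≫ U.p
    μ := fun X Y => D.π X Y
    μ_natural_left := fun f Y => by
      have h := D.π_tensorMap f (𝟙 Y)
      rw [Monad.Algebra.id_f, tensorHom_id] at h
      exact h.symm
    μ_natural_right := fun Y f => by
      have h := D.π_tensorMap (𝟙 Y) f
      rw [Monad.Algebra.id_f, id_tensorHom] at h
      exact h.symm
    associativity := fun X Y Z => by
      have h := D.π_assoc_hom X Y Z
      rw [πLeft, Category.assoc] at h
      exact h
    left_unitality := fun X => by
      have h := inv_leftUnit U X
      rw [Category.assoc, Iso.inv_comp_eq, Category.comp_id, Category.assoc] at h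
      exact h.symm
    right_unitality := fun X => by
      have h := inv_rightUnit U X
      rw [Category.assoc, Iso.inv_comp_eq, Category.comp_id, Category.assoc] at h
      exact h.symm }

/-- The forgetful functor is opmonoidal by means of the inclusions `ι`. -/
noncomputable abbrev forgetOplax : @Functor.OplaxMonoidal _ _ (monoidal U) C _ _ T.forget :=
  letI := monoidal U
  { η := U.counit
    δ := fun X Y => D.ι X Y
    δ_natural_left := fun f Y => (D.tensorMap_id_ι f Y).symm
    δ_natural_right := fun Y f => (D.id_tensorMap_ι f Y).symm
    oplax_associativity := fun X Y Z => (D.assoc_hom_ι_ι X Y Z).symm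
    oplax_left_unitality := fun X => by
      have h : (leftUnitorAlg U X).inv.f ≫ leftUnit U X = 𝟙 _ := inv_leftUnit U X
      rw [leftUnit, ← Category.assoc, ← Category.assoc, Iso.comp_hom_eq_id, Category.assoc] at h
      exact h.symm
    oplax_right_unitality := fun X => by
      have h : (rightUnitorAlg U X).inv.f ≫ rightUnit U X = 𝟙 _ := inv_rightUnit U X
      rw [rightUnit, ← Category.assoc, ← Category.assoc, Iso.comp_hom_eq_id, Category.assoc] at h
      exact h.symm }

/-- A monad with weakly opmonoidal structure is a weak bimonad. The second Frobenius condition is the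
first one for the reversed tensor product. -/
noncomputable def toWeakBimonad : WeakBimonad T :=
  letI := monoidal U
  { monoidal := monoidal U
    lax := forgetLax U
    oplax := forgetOplax U
    frobenius_left := D.frobenius_left
    frobenius_right := fun X Y Z => @frobenius_left C _ (revMonoidal C) _ T D.rev Z Y X
    separable := fun X Y => D.ι_π X Y }

theorem toWeakBimonad_comul (X Y : C) : (toWeakBimonad U).comul X Y = D.t2 X Y := by
  change T.map ((T.η.app X ⊗ₘ T.η.app Y) ≫ D.π (T.free.obj X) (T.free.obj Y)) ≫
    (D.tensor (T.free.obj X) (T.free.obj Y)).a ≫ D.ι (T.free.obj X) (T.free.obj Y) = D.t2 X Y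
  refine (D.map_comp_π_a_ι (X := T.free.obj X) (Y := T.free.obj Y) _).trans ?_
  change T.map (T.η.app X ⊗ₘ T.η.app Y) ≫ D.t2 (T.obj X) (T.obj Y) ≫ (T.μ.app X ⊗ₘ T.μ.app Y) = _
  rw [reassoc_of% (D.natural (T.η.app X) (T.η.app Y)), tensorHom_comp_tensorHom, T.right_unit,
    T.right_unit]
  exact (congrArg (fun k => D.t2 X Y ≫ k) (id_tensorHom_id _ _)).trans (Category.comp_id _)

theorem toWeakBimonad_counit : (toWeakBimonad U).counit = D.t0 := by
  change T.map (T.η.app (𝟙_ C) ≫ U.p) ≫ U.alg.a ≫ U.counit = D.t0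
  rw [Functor.map_comp, Category.assoc, reassoc_of% U.p_a]
  exact (T.right_unit_assoc _ _).trans U.p_counit

theorem exists_weakBimonad (D : WeakOpmonoidal T) : ∃ W : WeakBimonad T,
    (∀ X Y : C, W.comul X Y = D.t2 X Y) ∧ W.counit = D.t0 :=
  let ⟨U⟩ := D.exists_unitAlgebra
  ⟨toWeakBimonad U, toWeakBimonad_comul U, toWeakBimonad_counit U⟩

end WeakBimonad
end WeakOpmonoidal

/-! ### Calculus in a duoidal category -/

namespace TwoMonoidal
variable {C : Type u} [Category.{v} C] [TwoMonoidal C]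

theorem circ_comp {X X' X'' Y Y' Y'' : C} (f : X ⟶ X') (g : Y ⟶ Y') (h : X' ⟶ X'') (k : Y' ⟶ Y'') :
    (f ⊚ₘ g) ≫ (h ⊚ₘ k) = (f ≫ h) ⊚ₘ (g ≫ k) :=
  @tensorHom_comp_tensorHom C _ circ _ _ _ _ _ _ f g h k

theorem bul_comp {X X' X'' Y Y' Y'' : C} (f : X ⟶ X') (g : Y ⟶ Y') (h : X' ⟶ X'') (k : Y' ⟶ Y'') :
    (f ⊡ₘ g) ≫ (h ⊡ₘ k) = (f ≫ h) ⊡ₘ (g ≫ k) :=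
  @tensorHom_comp_tensorHom C _ bul _ _ _ _ _ _ f g h k

theorem circ_id (X Y : C) : 𝟙 X ⊚ₘ 𝟙 Y = 𝟙 (X ⊚ Y) := @id_tensorHom_id C _ circ X Y

theorem bul_id (X Y : C) : 𝟙 X ⊡ₘ 𝟙 Y = 𝟙 (X ⊡ Y) := @id_tensorHom_id C _ bul X Y

theorem cα_naturality {X X' Y Y' Z Z' : C} (f : X ⟶ X') (g : Y ⟶ Y') (h : Z ⟶ Z') :
    ((f ⊚ₘ g) ⊚ₘ h) ≫ (cα X' Y' Z').hom = (cα X Y Z).hom ≫ (f ⊚ₘ (g ⊚ₘ h)) :=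
  @associator_naturality C _ circ _ _ _ _ _ _ f g h

theorem bα_naturality {X X' Y Y' Z Z' : C} (f : X ⟶ X') (g : Y ⟶ Y') (h : Z ⟶ Z') :
    ((f ⊡ₘ g) ⊡ₘ h) ≫ (bα X' Y' Z').hom = (bα X Y Z).hom ≫ (f ⊡ₘ (g ⊡ₘ h)) :=
  @associator_naturality C _ bul _ _ _ _ _ _ f g h

theorem cα_inv_naturality {X X' Y Y' Z Z' : C} (f : X ⟶ X') (g : Y ⟶ Y') (h : Z ⟶ Z') :
    (f ⊚ₘ (g ⊚ₘ h)) ≫ (cα X' Y' Z').inv = (cα X Y Z).inv ≫ ((f ⊚ₘ g) ⊚ₘ h) :=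
  @associator_inv_naturality C _ circ _ _ _ _ _ _ f g h

theorem bα_inv_naturality {X X' Y Y' Z Z' : C} (f : X ⟶ X') (g : Y ⟶ Y') (h : Z ⟶ Z') :
    (f ⊡ₘ (g ⊡ₘ h)) ≫ (bα X' Y' Z').inv = (bα X Y Z).inv ≫ ((f ⊡ₘ g) ⊡ₘ h) :=
  @associator_inv_naturality C _ bul _ _ _ _ _ _ f g h

theorem cl_inv_naturality {X Y : C} (f : X ⟶ Y) :
    f ≫ (cl Y).inv = (cl X).inv ≫ (𝟙 𝕀 ⊚ₘ f) := by
  rw [show (𝟙 (𝕀 : C) ⊚ₘ f) = _ from @id_tensorHom C _ circ 𝕀 _ _ f]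
  exact @leftUnitor_inv_naturality C _ circ _ _ f

theorem bl_naturality {X Y : C} (f : X ⟶ Y) :
    (𝟙 𝕁 ⊡ₘ f) ≫ (bl Y).hom = (bl X).hom ≫ f := by
  rw [show (𝟙 (𝕁 : C) ⊡ₘ f) = _ from @id_tensorHom C _ bul 𝕁 _ _ f]
  exact @MonoidalCategory.leftUnitor_naturality C _ bul _ _ f

theorem cl_inv_whisker (X Y : C) :
    ((cl X).inv ⊚ₘ 𝟙 Y) ≫ (cα 𝕀 X Y).hom = (cl (X ⊚ Y)).inv := by
  let _ := circ (C := C)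
  change ((λ_ X).inv ⊗ₘ 𝟙 Y) ≫ (α_ _ _ _).hom = (λ_ (X ⊗ Y)).inv
  rw [tensorHom_id]
  monoidal

theorem cr_whisker (X Y : C) :
    ((cr X).hom ⊚ₘ 𝟙 Y) = (cα X 𝕀 Y).hom ≫ (𝟙 X ⊚ₘ (cl Y).hom) := by
  let _ := circ (C := C)
  change ((ρ_ X).hom ⊗ₘ 𝟙 Y) = (α_ _ _ _).hom ≫ (𝟙 X ⊗ₘ (λ_ Y).hom)
  rw [tensorHom_id, id_tensorHom]
  monoidal

theorem bl_inv_whisker (X Y : C) :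
    ((bl X).inv ⊡ₘ 𝟙 Y) ≫ (bα 𝕁 X Y).hom = (bl (X ⊡ Y)).inv := by
  let _ := bul (C := C)
  change ((λ_ X).inv ⊗ₘ 𝟙 Y) ≫ (α_ _ _ _).hom = (λ_ (X ⊗ Y)).inv
  rw [tensorHom_id]
  monoidal

theorem bl_whisker (X Y : C) :
    (bα 𝕁 X Y).inv ≫ ((bl X).hom ⊡ₘ 𝟙 Y) = (bl (X ⊡ Y)).hom := by
  let _ := bul (C := C)
  change (α_ _ _ _).inv ≫ ((λ_ X).hom ⊗ₘ 𝟙 Y) = (λ_ (X ⊗ Y)).hom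
  rw [tensorHom_id]
  monoidal

end TwoMonoidal

open TwoMonoidal

namespace Duoidal
variable {C : Type u} [Category.{v} C] [Duoidal C]

theorem ζ_natural_left {X X' Y Y' : C} (f : X ⟶ X') (g : Y ⟶ Y') (Z W : C) :
    ((f ⊡ₘ g) ⊚ₘ 𝟙 (Z ⊡ W)) ≫ ζ X' Y' Z W = ζ X Y Z W ≫ ((f ⊚ₘ 𝟙 Z) ⊡ₘ (g ⊚ₘ 𝟙 W)) := by
  rw [← bul_id, ζ_natural]

theorem ζ_natural_right (X Y : C) {Z Z' W W' : C} (f : Z ⟶ Z') (g : W ⟶ W') :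
    (𝟙 (X ⊡ Y) ⊚ₘ (f ⊡ₘ g)) ≫ ζ X Y Z' W' = ζ X Y Z W ≫ ((𝟙 X ⊚ₘ f) ⊡ₘ (𝟙 Y ⊚ₘ g)) := by
  rw [← bul_id, ζ_natural]

theorem ζ_bul_assoc' (X Y Z W U V : C) :
    ζ (X ⊡ Y) Z (W ⊡ U) V ≫ (ζ X Y W U ⊡ₘ 𝟙 (Z ⊚ V)) =
      ((bα X Y Z).hom ⊚ₘ (bα W U V).hom) ≫ ζ X (Y ⊡ Z) W (U ⊡ V) ≫ (𝟙 (X ⊚ W) ⊡ₘ ζ Y Z U V) ≫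
        (bα (X ⊚ W) (Y ⊚ U) (Z ⊚ V)).inv := by
  rw [← cancel_mono (bα (X ⊚ W) (Y ⊚ U) (Z ⊚ V)).hom]
  simp only [Category.assoc, ζ_bul_assoc, Iso.inv_hom_id, Category.comp_id]

theorem ζ_circ_assoc' (X Y Z W U V : C) :
    (ζ X Y Z W ⊚ₘ 𝟙 (U ⊡ V)) ≫ ζ (X ⊚ Z) (Y ⊚ W) U V =
      (cα (X ⊡ Y) (Z ⊡ W) (U ⊡ V)).hom ≫ (𝟙 (X ⊡ Y) ⊚ₘ ζ Z W U V) ≫ ζ X Y (Z ⊚ U) (W ⊚ V) ≫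
        ((cα X Z U).inv ⊡ₘ (cα Y W V).inv) := by
  have h := congrArg (fun k => k ≫ ((cα X Z U).inv ⊡ₘ (cα Y W V).inv)) (ζ_circ_assoc X Y Z W U V)
  simpa only [Category.assoc, bul_comp, Iso.hom_inv_id, bul_id, Category.comp_id] using h

end Duoidal

open Duoidal

/-! ### The opmonoidal functor `A ⊚ -` -/

namespace MonoidComonoid
variable {C : Type u} [Category.{v} C] [Duoidal C] {A : C} (S : MonoidComonoid A)

/-- The comultiplicativity constraint of the functor `A ⊚ -`. -/
def opMul (X Y : C) : A ⊚ (X ⊡ Y) ⟶ (A ⊚ X) ⊡ (A ⊚ Y) := (S.Δ ⊚ₘ 𝟙 (X ⊡ Y)) ≫ ζ A A X Y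

theorem opMul_natural {X X' Y Y' : C} (f : X ⟶ X') (g : Y ⟶ Y') :
    (𝟙 A ⊚ₘ (f ⊡ₘ g)) ≫ S.opMul X' Y' = S.opMul X Y ≫ ((𝟙 A ⊚ₘ f) ⊡ₘ (𝟙 A ⊚ₘ g)) := by
  have h := circ_comp (𝟙 A) (f ⊡ₘ g) S.Δ (𝟙 _)
  have h' := circ_comp S.Δ (𝟙 _) (𝟙 _) (f ⊡ₘ g)
  rw [Category.id_comp, Category.comp_id] at h h'
  rw [opMul, opMul, reassoc_of% h, ← h', Category.assoc, Category.assoc, ζ_natural_right]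

theorem Δ_coassoc : S.Δ ≫ (S.Δ ⊡ₘ 𝟙 A) ≫ (bα A A A).hom = S.Δ ≫ (𝟙 A ⊡ₘ S.Δ) := by
  have h := @ComonObj.comul_assoc C _ bul A S.comon
  rw [← @id_tensorHom C _ bul, ← @tensorHom_id C _ bul] at h
  exact h.symm

theorem Δ_ε_left : S.Δ ≫ (S.ε ⊡ₘ 𝟙 A) = (bl A).inv := by
  have h := @ComonObj.counit_comul C _ bul A S.comon
  rw [← @tensorHom_id C _ bul] at h
  exact h

theorem opMul_coassoc (X Y Z : C) :
    S.opMul (X ⊡ Y) Z ≫ (S.opMul X Y ⊡ₘ 𝟙 (A ⊚ Z)) ≫ (bα _ _ _).hom =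
      (𝟙 A ⊚ₘ (bα X Y Z).hom) ≫ S.opMul X (Y ⊡ Z) ≫ (𝟙 (A ⊚ X) ⊡ₘ S.opMul Y Z) := by
  have e₁ : (S.opMul X Y ⊡ₘ 𝟙 (A ⊚ Z)) =
      ((S.Δ ⊚ₘ 𝟙 (X ⊡ Y)) ⊡ₘ (𝟙 A ⊚ₘ 𝟙 Z)) ≫ (ζ A A X Y ⊡ₘ 𝟙 (A ⊚ Z)) := by
    rw [bul_comp, opMul, circ_id, Category.comp_id]
  have e₂ : (𝟙 (A ⊚ X) ⊡ₘ S.opMul Y Z) =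
      ((𝟙 A ⊚ₘ 𝟙 X) ⊡ₘ (S.Δ ⊚ₘ 𝟙 (Y ⊡ Z))) ≫ (𝟙 (A ⊚ X) ⊡ₘ ζ A A Y Z) := by
    rw [bul_comp, opMul, circ_id, Category.comp_id]
  rw [e₁, e₂, opMul, opMul]
  simp only [Category.assoc]
  rw [← reassoc_of% (ζ_natural_left S.Δ (𝟙 A) (X ⊡ Y) Z), ζ_bul_assoc,
    ← reassoc_of% (ζ_natural_left (𝟙 A) S.Δ X (Y ⊡ Z))]
  have h := S.Δ_coassoc
  simp only [← Category.assoc, circ_comp, Category.comp_id, Category.id_comp] at h ⊢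
  rw [h]

theorem opMul_counit_left (X : C) :
    S.opMul 𝕁 X ≫ (((S.ε ⊚ₘ 𝟙 𝕁) ≫ ϖ) ⊡ₘ 𝟙 (A ⊚ X)) ≫ (bl _).hom = 𝟙 A ⊚ₘ (bl X).hom := by
  have e₁ : (((S.ε ⊚ₘ 𝟙 𝕁) ≫ ϖ) ⊡ₘ 𝟙 (A ⊚ X)) =
      ((S.ε ⊚ₘ 𝟙 𝕁) ⊡ₘ (𝟙 A ⊚ₘ 𝟙 X)) ≫ (ϖ ⊡ₘ 𝟙 (A ⊚ X)) := by
    rw [bul_comp, circ_id, Category.comp_id]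
  have e₂ : (S.Δ ⊚ₘ 𝟙 (𝕁 ⊡ X)) ≫ ((S.ε ⊡ₘ 𝟙 A) ⊚ₘ 𝟙 (𝕁 ⊡ X)) =
      (𝟙 A ⊚ₘ (bl X).hom) ≫ ((bl A).inv ⊚ₘ (bl X).inv) := by
    rw [circ_comp, circ_comp, Δ_ε_left, Category.id_comp, Category.id_comp, Iso.hom_inv_id]
  rw [e₁, opMul]
  simp only [Category.assoc]
  rw [← reassoc_of% (ζ_natural_left S.ε (𝟙 A) 𝕁 X), reassoc_of% e₂, reassoc_of% (ζ_ϖ_left A X),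
    Iso.inv_hom_id, Category.comp_id]

/-- The multiplication of the monad `A ⊚ -`. -/
def mulMap (X : C) : A ⊚ (A ⊚ X) ⟶ A ⊚ X := (cα A A X).inv ≫ (S.μ ⊚ₘ 𝟙 X)

theorem mul_opMul (h : S.WB) (X Y : C) :
    S.mulMap (X ⊡ Y) ≫ S.opMul X Y =
      (𝟙 A ⊚ₘ S.opMul X Y) ≫ S.opMul (A ⊚ X) (A ⊚ Y) ≫ (S.mulMap X ⊡ₘ S.mulMap Y) := by
  have e₁ : (S.μ ⊚ₘ 𝟙 (X ⊡ Y)) ≫ (S.Δ ⊚ₘ 𝟙 (X ⊡ Y)) =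
      ((S.Δ ⊚ₘ S.Δ) ⊚ₘ 𝟙 (X ⊡ Y)) ≫ (ζ A A A A ⊚ₘ 𝟙 (X ⊡ Y)) ≫ ((S.μ ⊡ₘ S.μ) ⊚ₘ 𝟙 (X ⊡ Y)) := by
    simp only [circ_comp, Category.comp_id]
    rw [h]
  have e₂ : (𝟙 A ⊚ₘ S.opMul X Y) ≫ (S.Δ ⊚ₘ 𝟙 _) =
      (S.Δ ⊚ₘ (S.Δ ⊚ₘ 𝟙 (X ⊡ Y))) ≫ (𝟙 (A ⊡ A) ⊚ₘ ζ A A X Y) := by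
    simp only [circ_comp, Category.comp_id, Category.id_comp, opMul]
  have e₃ : S.opMul (A ⊚ X) (A ⊚ Y) ≫ (S.mulMap X ⊡ₘ S.mulMap Y) =
      (S.Δ ⊚ₘ 𝟙 _) ≫ ζ A A (A ⊚ X) (A ⊚ Y) ≫
        ((cα A A X).inv ⊡ₘ (cα A A Y).inv) ≫ ((S.μ ⊚ₘ 𝟙 X) ⊡ₘ (S.μ ⊚ₘ 𝟙 Y)) := by
    rw [bul_comp, opMul, Category.assoc, mulMap, mulMap]
  rw [e₃, reassoc_of% e₂, mulMap, opMul, Category.assoc, reassoc_of% e₁,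
    ζ_natural_left, reassoc_of% (ζ_circ_assoc' A A A A X Y),
    reassoc_of% (cα_naturality S.Δ S.Δ (𝟙 (X ⊡ Y))), Iso.inv_hom_id_assoc]

/-! ### The unit on threefold products -/

/-- The component `X ⊡ Y ⟶ (A ⊚ X) ⊡ (A ⊚ Y)` of the unit followed by the comultiplicativity
constraint of `A ⊚ -`. -/
def χ (X Y : C) : X ⊡ Y ⟶ (A ⊚ X) ⊡ (A ⊚ Y) :=
  (cl (X ⊡ Y)).inv ≫ ((S.η ≫ S.Δ) ⊚ₘ 𝟙 (X ⊡ Y)) ≫ ζ A A X Y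

/-- The coproduct of the unit, with a factor `𝕀` split off to the left by `δ`. -/
def unitSplit : (𝕀 : C) ⟶ (𝕀 ⊡ A) ⊡ A := δ ≫ (𝟙 𝕀 ⊡ₘ (S.η ≫ S.Δ)) ≫ (bα 𝕀 A A).inv

/-- Letting `unitSplit` act on a threefold product, its factor `𝕀` has no effect on `X`. -/
theorem unitSplit_ζ (X Y Z : C) :
    (cl ((X ⊡ Y) ⊡ Z)).inv ≫ (S.unitSplit ⊚ₘ 𝟙 ((X ⊡ Y) ⊡ Z)) ≫ ζ (𝕀 ⊡ A) A (X ⊡ Y) Z ≫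
        ((ζ 𝕀 A X Y ≫ ((cl X).hom ⊡ₘ 𝟙 (A ⊚ Y))) ⊡ₘ 𝟙 (A ⊚ Z)) =
      (bα X Y Z).hom ≫ (𝟙 X ⊡ₘ S.χ Y Z) ≫ (bα X (A ⊚ Y) (A ⊚ Z)).inv := by
  have e₁ : ((ζ 𝕀 A X Y ≫ ((cl X).hom ⊡ₘ 𝟙 (A ⊚ Y))) ⊡ₘ 𝟙 (A ⊚ Z)) =
      (ζ 𝕀 A X Y ⊡ₘ 𝟙 (A ⊚ Z)) ≫ (((cl X).hom ⊡ₘ 𝟙 (A ⊚ Y)) ⊡ₘ 𝟙 (A ⊚ Z)) := by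
    rw [bul_comp, Category.comp_id]
  have e₂ : (S.unitSplit ⊚ₘ 𝟙 ((X ⊡ Y) ⊡ Z)) ≫ ((bα 𝕀 A A).hom ⊚ₘ (bα X Y Z).hom) =
      (𝟙 𝕀 ⊚ₘ (bα X Y Z).hom) ≫ (δ ⊚ₘ 𝟙 (X ⊡ (Y ⊡ Z))) ≫
        ((𝟙 𝕀 ⊡ₘ (S.η ≫ S.Δ)) ⊚ₘ 𝟙 (X ⊡ (Y ⊡ Z))) := by
    simp only [circ_comp, unitSplit, Category.assoc, Iso.inv_hom_id, Category.comp_id,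
      Category.id_comp]
  have e₃ : ((𝟙 𝕀 ⊚ₘ 𝟙 X) ⊡ₘ ((S.η ≫ S.Δ) ⊚ₘ 𝟙 (Y ⊡ Z))) ≫ (𝟙 (𝕀 ⊚ X) ⊡ₘ ζ A A Y Z) ≫
      ((cl X).hom ⊡ₘ (𝟙 (A ⊚ Y) ⊡ₘ 𝟙 (A ⊚ Z))) =
      ((cl X).hom ⊡ₘ (cl (Y ⊡ Z)).hom) ≫ (𝟙 X ⊡ₘ S.χ Y Z) := by
    simp only [bul_comp, circ_id, bul_id, Category.comp_id, Category.id_comp, χ,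
      Iso.hom_inv_id_assoc]
  rw [e₁, reassoc_of% (ζ_bul_assoc' 𝕀 A A X Y Z), ← bα_inv_naturality, reassoc_of% e₂,
    reassoc_of% (ζ_natural_left (𝟙 𝕀) (S.η ≫ S.Δ) X (Y ⊡ Z)), reassoc_of% e₃,
    reassoc_of% (ζ_δ_left X (Y ⊡ Z)), ← reassoc_of% (cl_inv_naturality (bα X Y Z).hom),
    Iso.inv_hom_id_assoc]

/-- The action of `𝕀 ⊡ A` through its second factor; the first one acts trivially on `𝕁`. -/
def ψ (X : C) : (𝕀 ⊡ A) ⊚ X ⟶ A ⊚ X :=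
  (𝟙 (𝕀 ⊡ A) ⊚ₘ (bl X).inv) ≫ ζ 𝕀 A 𝕁 X ≫ ((cl 𝕁).hom ⊡ₘ 𝟙 (A ⊚ X)) ≫ (bl (A ⊚ X)).hom

theorem unitSplit_ψ (X Y : C) :
    (cl (X ⊡ Y)).inv ≫ (S.unitSplit ⊚ₘ 𝟙 (X ⊡ Y)) ≫ ζ (𝕀 ⊡ A) A X Y ≫ (ψ X ⊡ₘ 𝟙 (A ⊚ Y)) =
      S.χ X Y := by
  have e₁ : (ψ (A := A) X ⊡ₘ 𝟙 (A ⊚ Y)) = ((𝟙 (𝕀 ⊡ A) ⊚ₘ (bl X).inv) ⊡ₘ (𝟙 A ⊚ₘ 𝟙 Y)) ≫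
      ((ζ 𝕀 A 𝕁 X ≫ ((cl 𝕁).hom ⊡ₘ 𝟙 (A ⊚ X))) ⊡ₘ 𝟙 (A ⊚ Y)) ≫
        ((bl (A ⊚ X)).hom ⊡ₘ 𝟙 (A ⊚ Y)) := by
    simp only [bul_comp, circ_id, Category.comp_id, ψ, Category.assoc]
  have e₂ : (S.unitSplit ⊚ₘ 𝟙 (X ⊡ Y)) ≫ (𝟙 ((𝕀 ⊡ A) ⊡ A) ⊚ₘ ((bl X).inv ⊡ₘ 𝟙 Y)) =
      (𝟙 𝕀 ⊚ₘ ((bl X).inv ⊡ₘ 𝟙 Y)) ≫ (S.unitSplit ⊚ₘ 𝟙 ((𝕁 ⊡ X) ⊡ Y)) := by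
    simp only [circ_comp, Category.comp_id, Category.id_comp]
  have h := S.unitSplit_ζ 𝕁 X Y
  rw [e₁, ← reassoc_of% (ζ_natural_right (𝕀 ⊡ A) A (bl X).inv (𝟙 Y)), reassoc_of% e₂,
    ← reassoc_of% (cl_inv_naturality ((bl X).inv ⊡ₘ 𝟙 Y)), reassoc_of% h, bl_whisker,
    reassoc_of% (bl_inv_whisker X Y), bl_naturality, Iso.inv_hom_id_assoc]

/-- The morphism `𝕀 ⊡ A ⟶ (𝕀 ⊡ A) ⊡ A` which multiplies the second factor by the unit, split as
`unitSplit`, from the left. -/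
def unitMul : 𝕀 ⊡ A ⟶ (𝕀 ⊡ A) ⊡ A :=
  (cl (𝕀 ⊡ A)).inv ≫ (S.unitSplit ⊚ₘ 𝟙 (𝕀 ⊡ A)) ≫ ζ (𝕀 ⊡ A) A 𝕀 A ≫ ((cr (𝕀 ⊡ A)).hom ⊡ₘ S.μ)

theorem unitMul_ψ (X Y : C) :
    (S.unitMul ⊚ₘ 𝟙 (X ⊡ Y)) ≫ ζ (𝕀 ⊡ A) A X Y ≫ (ψ X ⊡ₘ 𝟙 (A ⊚ Y)) =
      ζ 𝕀 A X Y ≫ ((cl X).hom ⊡ₘ 𝟙 (A ⊚ Y)) ≫ S.χ X (A ⊚ Y) ≫ (𝟙 (A ⊚ X) ⊡ₘ S.mulMap Y) := by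
  have e₁ : (S.unitMul ⊚ₘ 𝟙 (X ⊡ Y)) = ((cl (𝕀 ⊡ A)).inv ⊚ₘ 𝟙 (X ⊡ Y)) ≫
      ((S.unitSplit ⊚ₘ 𝟙 (𝕀 ⊡ A)) ⊚ₘ 𝟙 (X ⊡ Y)) ≫ (ζ (𝕀 ⊡ A) A 𝕀 A ⊚ₘ 𝟙 (X ⊡ Y)) ≫
        (((cr (𝕀 ⊡ A)).hom ⊡ₘ S.μ) ⊚ₘ 𝟙 (X ⊡ Y)) := by
    simp only [circ_comp, Category.comp_id, unitMul]
  have e₂ : ((cα (𝕀 ⊡ A) 𝕀 X).inv ⊡ₘ (cα A A Y).inv) ≫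
      (((cr (𝕀 ⊡ A)).hom ⊚ₘ 𝟙 X) ⊡ₘ (S.μ ⊚ₘ 𝟙 Y)) ≫ (ψ X ⊡ₘ 𝟙 (A ⊚ Y)) =
      ((𝟙 (𝕀 ⊡ A) ⊚ₘ (cl X).hom) ⊡ₘ (𝟙 A ⊚ₘ 𝟙 (A ⊚ Y))) ≫ (ψ X ⊡ₘ 𝟙 (A ⊚ (A ⊚ Y))) ≫
        (𝟙 (A ⊚ X) ⊡ₘ S.mulMap Y) := by
    simp only [bul_comp, cr_whisker, circ_id, Category.comp_id, Category.id_comp, mulMap,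
      Iso.inv_hom_id_assoc, Category.assoc]
  have e₃ : (S.unitSplit ⊚ₘ (𝟙 (𝕀 ⊡ A) ⊚ₘ 𝟙 (X ⊡ Y))) ≫
      (𝟙 ((𝕀 ⊡ A) ⊡ A) ⊚ₘ ζ 𝕀 A X Y) ≫ (𝟙 ((𝕀 ⊡ A) ⊡ A) ⊚ₘ ((cl X).hom ⊡ₘ 𝟙 (A ⊚ Y))) =
      (𝟙 𝕀 ⊚ₘ (ζ 𝕀 A X Y ≫ ((cl X).hom ⊡ₘ 𝟙 (A ⊚ Y)))) ≫ (S.unitSplit ⊚ₘ 𝟙 _) := by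
    simp only [circ_comp, circ_id, Category.comp_id, Category.id_comp]
  have h := S.unitSplit_ψ X (A ⊚ Y)
  rw [e₁]
  simp only [Category.assoc]
  rw [reassoc_of% (ζ_natural_left (cr (𝕀 ⊡ A)).hom S.μ X Y),
    reassoc_of% (ζ_circ_assoc' (𝕀 ⊡ A) A 𝕀 A X Y), e₂,
    ← reassoc_of% (ζ_natural_right (𝕀 ⊡ A) A (cl X).hom (𝟙 (A ⊚ Y))),
    reassoc_of% (cα_naturality S.unitSplit (𝟙 (𝕀 ⊡ A)) (𝟙 (X ⊡ Y))), reassoc_of% e₃,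
    reassoc_of% (cl_inv_whisker (𝕀 ⊡ A) (X ⊡ Y)),
    ← reassoc_of% (cl_inv_naturality (ζ 𝕀 A X Y ≫ ((cl X).hom ⊡ₘ 𝟙 (A ⊚ Y)))), reassoc_of% h]

/-- The action of a morphism `𝕀 ⟶ ((𝕀 ⊡ A) ⊡ A) ⊡ A` on a threefold product, the factor `𝕀` being
discarded. Both sides of `RLU` are such morphisms. -/
def tripleAct (f : 𝕀 ⟶ ((𝕀 ⊡ A) ⊡ A) ⊡ A) (X Y Z : C) :
    (X ⊡ Y) ⊡ Z ⟶ ((A ⊚ X) ⊡ (A ⊚ Y)) ⊡ (A ⊚ Z) :=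
  (cl ((X ⊡ Y) ⊡ Z)).inv ≫ (f ⊚ₘ 𝟙 ((X ⊡ Y) ⊡ Z)) ≫ ζ ((𝕀 ⊡ A) ⊡ A) A (X ⊡ Y) Z ≫
    (ζ (𝕀 ⊡ A) A X Y ⊡ₘ 𝟙 (A ⊚ Z)) ≫ ((ψ X ⊡ₘ 𝟙 (A ⊚ Y)) ⊡ₘ 𝟙 (A ⊚ Z))

theorem tripleAct_comul (X Y Z : C) :
    tripleAct (S.unitSplit ≫ (𝟙 (𝕀 ⊡ A) ⊡ₘ S.Δ) ≫ (bα (𝕀 ⊡ A) A A).inv) X Y Z =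
      (bα X Y Z).hom ≫ S.χ X (Y ⊡ Z) ≫ (𝟙 (A ⊚ X) ⊡ₘ S.opMul Y Z) ≫ (bα _ _ _).inv := by
  have e₁ : ((S.unitSplit ≫ (𝟙 (𝕀 ⊡ A) ⊡ₘ S.Δ) ≫ (bα (𝕀 ⊡ A) A A).inv) ⊚ₘ 𝟙 ((X ⊡ Y) ⊡ Z)) ≫
      ((bα (𝕀 ⊡ A) A A).hom ⊚ₘ (bα X Y Z).hom) = (𝟙 𝕀 ⊚ₘ (bα X Y Z).hom) ≫
        (S.unitSplit ⊚ₘ 𝟙 _) ≫ ((𝟙 (𝕀 ⊡ A) ⊡ₘ S.Δ) ⊚ₘ 𝟙 (X ⊡ (Y ⊡ Z))) := by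
    simp only [circ_comp, Category.assoc, Iso.inv_hom_id, Category.comp_id, Category.id_comp]
  have e₂ : ((𝟙 (𝕀 ⊡ A) ⊚ₘ 𝟙 X) ⊡ₘ (S.Δ ⊚ₘ 𝟙 (Y ⊡ Z))) ≫ (𝟙 _ ⊡ₘ ζ A A Y Z) ≫
      (ψ X ⊡ₘ (𝟙 (A ⊚ Y) ⊡ₘ 𝟙 (A ⊚ Z))) = (ψ X ⊡ₘ 𝟙 _) ≫ (𝟙 (A ⊚ X) ⊡ₘ S.opMul Y Z) := by
    simp only [bul_comp, bul_id, circ_id, Category.comp_id, Category.id_comp, opMul]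
  have h := S.unitSplit_ψ X (Y ⊡ Z)
  rw [tripleAct, reassoc_of% (ζ_bul_assoc' (𝕀 ⊡ A) A A X Y Z), ← bα_inv_naturality,
    reassoc_of% e₁, reassoc_of% (ζ_natural_left (𝟙 (𝕀 ⊡ A)) S.Δ X (Y ⊡ Z)), reassoc_of% e₂,
    ← reassoc_of% (cl_inv_naturality (bα X Y Z).hom), reassoc_of% h]

theorem tripleAct_mul (X Y Z : C) :
    tripleAct (S.unitSplit ≫ (S.unitMul ⊡ₘ 𝟙 A)) X Y Z =
      (bα X Y Z).hom ≫ (𝟙 X ⊡ₘ S.χ Y Z) ≫ (bα _ _ _).inv ≫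
        ((S.χ X (A ⊚ Y) ≫ (𝟙 (A ⊚ X) ⊡ₘ S.mulMap Y)) ⊡ₘ 𝟙 (A ⊚ Z)) := by
  have e₁ : ((S.unitSplit ≫ (S.unitMul ⊡ₘ 𝟙 A)) ⊚ₘ 𝟙 ((X ⊡ Y) ⊡ Z)) =
      (S.unitSplit ⊚ₘ 𝟙 ((X ⊡ Y) ⊡ Z)) ≫ ((S.unitMul ⊡ₘ 𝟙 A) ⊚ₘ 𝟙 ((X ⊡ Y) ⊡ Z)) := by
    rw [circ_comp, Category.comp_id]
  have e₂ : ((S.unitMul ⊚ₘ 𝟙 (X ⊡ Y)) ⊡ₘ (𝟙 A ⊚ₘ 𝟙 Z)) ≫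
      (ζ (𝕀 ⊡ A) A X Y ⊡ₘ 𝟙 (A ⊚ Z)) ≫ ((ψ X ⊡ₘ 𝟙 (A ⊚ Y)) ⊡ₘ 𝟙 (A ⊚ Z)) =
      ((ζ 𝕀 A X Y ≫ ((cl X).hom ⊡ₘ 𝟙 (A ⊚ Y))) ⊡ₘ 𝟙 (A ⊚ Z)) ≫
        ((S.χ X (A ⊚ Y) ≫ (𝟙 (A ⊚ X) ⊡ₘ S.mulMap Y)) ⊡ₘ 𝟙 (A ⊚ Z)) := by
    simp only [bul_comp, circ_id, Category.comp_id, unitMul_ψ, Category.assoc]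
  have h := S.unitSplit_ζ X Y Z
  rw [tripleAct, e₁, Category.assoc,
    reassoc_of% (ζ_natural_left S.unitMul (𝟙 A) (X ⊡ Y) Z), e₂, reassoc_of% h]

/-- The condition `RLU`, an identity between morphisms out of `𝕀`, transported to threefold products:
it is the axiom `unit_left` of a weakly opmonoidal monad. -/
theorem χ_opMul (h : S.RLU) (X Y Z : C) :
    S.χ X (Y ⊡ Z) ≫ (𝟙 (A ⊚ X) ⊡ₘ S.opMul Y Z) =
      (𝟙 X ⊡ₘ S.χ Y Z) ≫ (bα _ _ _).inv ≫
        ((S.χ X (A ⊚ Y) ≫ (𝟙 (A ⊚ X) ⊡ₘ S.mulMap Y)) ⊡ₘ 𝟙 (A ⊚ Z)) ≫ (bα _ _ _).hom := by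
  -- `RLU`, with its two sides written by means of `unitSplit` and `unitMul`.
  have h' : S.unitSplit ≫ (𝟙 (𝕀 ⊡ A) ⊡ₘ S.Δ) ≫ (bα (𝕀 ⊡ A) A A).inv =
      S.unitSplit ≫ (S.unitMul ⊡ₘ 𝟙 A) := by
    have e₁ : S.unitSplit ≫ (𝟙 (𝕀 ⊡ A) ⊡ₘ S.Δ) ≫ (bα (𝕀 ⊡ A) A A).inv =
        S.unitRight ≫ (bα 𝕀 A (A ⊡ A)).inv ≫ (bα (𝕀 ⊡ A) A A).inv := by
      have e := bα_inv_naturality (𝟙 (𝕀 : C)) (𝟙 A) S.Δ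
      rw [bul_id] at e
      simp only [unitRight, unitSplit, Category.assoc, reassoc_of% e]
      rw [← Category.assoc (𝟙 𝕀 ⊡ₘ S.η) (𝟙 𝕀 ⊡ₘ S.Δ), bul_comp, Category.comp_id]
    have e₂ : (S.unitSplit ⊚ₘ 𝟙 (𝕀 ⊡ A)) = (δ ⊚ₘ 𝟙 (𝕀 ⊡ A)) ≫
        ((𝟙 𝕀 ⊡ₘ (S.η ≫ S.Δ)) ⊚ₘ 𝟙 (𝕀 ⊡ A)) ≫ ((bα 𝕀 A A).inv ⊚ₘ 𝟙 (𝕀 ⊡ A)) := by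
      simp only [circ_comp, unitSplit, Category.comp_id]
    rw [e₁, h, unitMul, e₂]
    simp only [unitSplit, bul_comp, Category.assoc, Category.comp_id]
  have h₁ := S.tripleAct_comul X Y Z
  rw [h', tripleAct_mul, Iso.cancel_iso_hom_left] at h₁
  have h₂ := congrArg (fun k => k ≫ (bα (A ⊚ X) (A ⊚ Y) (A ⊚ Z)).hom) h₁
  simp only [Category.assoc, Iso.inv_hom_id, Category.comp_id] at h₂ ⊢
  exact h₂.symm

end MonoidComonoid

/-! ### The reversed duoidal category, and the weak bimonad `A ⊚ -` -/

/-- The duoidal category with the factors of every product `⊡` interchanged. -/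
abbrev revDuoidal (C : Type u) [Category.{v} C] [Duoidal C] : Duoidal C where
  circ := circ
  bul := @revMonoidal C _ bul
  δ := δ
  ϖ := ϖ
  τ := τ
  ζ X Y Z W := ζ Y X W Z
  ζ_natural f g h k := ζ_natural g f k h
  ϖ_assoc := ϖ_assoc
  τ_ϖ := τ_ϖ
  ϖ_τ := ϖ_τ
  δ_coassoc := by
    change (δ : (𝕀 : C) ⟶ _) ≫ (𝟙 𝕀 ⊡ₘ δ) ≫ (bα 𝕀 𝕀 𝕀).inv = δ ≫ (δ ⊡ₘ 𝟙 𝕀)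
    rw [← reassoc_of% (δ_coassoc (C := C)), Iso.hom_inv_id, Category.comp_id]
  δ_τ_left := δ_τ_right
  δ_τ_right := δ_τ_left
  ζ_circ_assoc X Y Z W U V := ζ_circ_assoc Y X W Z V U
  ζ_bul_assoc X Y Z W U V := by
    change ζ Z (Y ⊡ X) V (U ⊡ W) ≫ (𝟙 (Z ⊚ V) ⊡ₘ ζ Y X U W) ≫ (bα (Z ⊚ V) (Y ⊚ U) (X ⊚ W)).inv =
      ((bα Z Y X).inv ⊚ₘ (bα V U W).inv) ≫ ζ (Z ⊡ Y) X (V ⊡ U) W ≫ (ζ Z Y V U ⊡ₘ 𝟙 (X ⊚ W))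
    have e : ((bα Z Y X).inv ⊚ₘ (bα V U W).inv) ≫ ((bα Z Y X).hom ⊚ₘ (bα V U W).hom) = 𝟙 _ := by
      rw [circ_comp, Iso.inv_hom_id, Iso.inv_hom_id, circ_id]
    rw [ζ_bul_assoc', reassoc_of% e]
  ζ_δ_left X Y := ζ_δ_left Y X
  ζ_δ_right X Y := ζ_δ_right Y X
  ζ_ϖ_left X Y := ζ_ϖ_right X Y
  ζ_ϖ_right X Y := ζ_ϖ_left X Y

namespace MonoidComonoid
variable {C : Type u} [Category.{v} C] [Duoidal C] {A : C} (S : MonoidComonoid A)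

theorem Δ_coassoc_inv : S.Δ ≫ (𝟙 A ⊡ₘ S.Δ) ≫ (bα A A A).inv = S.Δ ≫ (S.Δ ⊡ₘ 𝟙 A) := by
  rw [← reassoc_of% S.Δ_coassoc, Iso.hom_inv_id, Category.comp_id]

theorem Δ_ε_right : S.Δ ≫ (𝟙 A ⊡ₘ S.ε) = (br A).inv := by
  have h := @ComonObj.comul_counit C _ bul A S.comon
  rw [← @id_tensorHom C _ bul] at h
  exact h

/-- The same structure in the reversed duoidal category. -/
def rev : @MonoidComonoid C _ (revDuoidal C) A :=
  @MonoidComonoid.mk C _ (revDuoidal C) A S.mon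
    (@ComonObj.mk C _ (@revMonoidal C _ bul) A S.ε S.Δ
      (by
        change S.Δ ≫ (bul (C := C)).whiskerLeft A S.ε = (br A).inv
        rw [← @id_tensorHom C _ bul]
        exact S.Δ_ε_right)
      (by
        change S.Δ ≫ (bul (C := C)).whiskerRight S.ε A = (bl A).inv
        rw [← @tensorHom_id C _ bul]
        exact S.Δ_ε_left)
      (by
        change S.Δ ≫ (bul (C := C)).whiskerRight S.Δ A =
          S.Δ ≫ (bul (C := C)).whiskerLeft A S.Δ ≫ (bα A A A).inv
        rw [← @tensorHom_id C _ bul, ← @id_tensorHom C _ bul]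
        exact S.Δ_coassoc_inv.symm))

theorem opMul_counit_right (X : C) :
    S.opMul X 𝕁 ≫ (𝟙 (A ⊚ X) ⊡ₘ ((S.ε ⊚ₘ 𝟙 𝕁) ≫ ϖ)) ≫ (br _).hom = 𝟙 A ⊚ₘ (br X).hom :=
  @opMul_counit_left C _ (revDuoidal C) A S.rev X

/-- The condition `LLU` is `RLU` in the reversed duoidal category, and yields `unit_right`. -/
theorem opMul_χ (h : S.LLU) (X Y Z : C) :
    S.χ (X ⊡ Y) Z ≫ (S.opMul X Y ⊡ₘ 𝟙 (A ⊚ Z)) =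
      (S.χ X Y ⊡ₘ 𝟙 Z) ≫ (bα _ _ _).hom ≫
        (𝟙 (A ⊚ X) ⊡ₘ (S.χ (A ⊚ Y) Z ≫ (S.mulMap Y ⊡ₘ 𝟙 (A ⊚ Z)))) ≫ (bα _ _ _).inv :=
  @χ_opMul C _ (revDuoidal C) A S.rev h Z Y X

/-- The constraint `A ⊚ 𝕁 ⟶ 𝕁` of the functor `A ⊚ -`. -/
def opUnit : A ⊚ 𝕁 ⟶ 𝕁 := (S.ε ⊚ₘ 𝟙 𝕁) ≫ ϖ

theorem circMonad_map {X Y : C} (f : X ⟶ Y) : S.circMonad.map f = 𝟙 A ⊚ₘ f :=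
  (@id_tensorHom C _ circ A _ _ f).symm

theorem circMonad_μ (X : C) : S.circMonad.μ.app X = S.mulMap X := by
  change (cα A A X).inv ≫ (circ (C := C)).whiskerRight S.μ X = _
  rw [← @tensorHom_id C _ circ]
  rfl

theorem mulMap_assoc (X : C) :
    (𝟙 A ⊚ₘ S.mulMap X) ≫ S.mulMap X = S.mulMap (A ⊚ X) ≫ S.mulMap X := by
  have h := S.circMonad.assoc X
  rw [circMonad_map, circMonad_μ, circMonad_μ] at h
  exact h

theorem mulMap_opUnit : S.mulMap 𝕁 ≫ S.opUnit = (cα A A 𝕁).inv ≫ ((S.μ ≫ S.ε) ⊚ₘ 𝟙 𝕁) ≫ ϖ := by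
  rw [mulMap, opUnit, Category.assoc, ← Category.assoc (S.μ ⊚ₘ 𝟙 𝕁), circ_comp, Category.comp_id]

theorem counitRight_eq : S.counitRight = S.mulMap (A ⊚ 𝕁) ≫ S.mulMap 𝕁 ≫ S.opUnit := by
  simp only [counitRight, mulMap, opUnit, Category.assoc]

/-- The condition `RRC` is the axiom `counit_mul_left` of a weakly opmonoidal monad. -/
theorem counit_mulMap_left (h : S.RRC) :
    (𝟙 A ⊚ₘ ((𝟙 A ⊚ₘ (br (A ⊚ 𝕁)).inv) ≫ S.opMul (A ⊚ 𝕁) 𝕁 ≫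
      ((S.mulMap 𝕁 ≫ S.opUnit) ⊡ₘ 𝟙 (A ⊚ 𝕁)) ≫ (bl (A ⊚ 𝕁)).hom)) ≫ S.mulMap 𝕁 ≫ S.opUnit =
      (𝟙 A ⊚ₘ S.mulMap 𝕁) ≫ S.mulMap 𝕁 ≫ S.opUnit := by
  rw [reassoc_of% (S.mulMap_assoc 𝕁), ← counitRight_eq, h, mulMap_opUnit, opMul]
  have e : (𝟙 A ⊚ₘ (br (A ⊚ 𝕁)).inv) ≫ (S.Δ ⊚ₘ 𝟙 _) =
      (S.Δ ⊚ₘ 𝟙 (A ⊚ 𝕁)) ≫ (𝟙 (A ⊡ A) ⊚ₘ (br (A ⊚ 𝕁)).inv) := by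
    simp only [circ_comp, Category.comp_id, Category.id_comp]
  rw [Category.assoc, reassoc_of% e]
  simp only [← Category.assoc, circ_comp, bul_comp, Category.comp_id]

theorem counit_mulMap_right (h : S.RLC) :
    (𝟙 A ⊚ₘ ((𝟙 A ⊚ₘ (bl (A ⊚ 𝕁)).inv) ≫ S.opMul 𝕁 (A ⊚ 𝕁) ≫
      (𝟙 (A ⊚ 𝕁) ⊡ₘ (S.mulMap 𝕁 ≫ S.opUnit)) ≫ (br (A ⊚ 𝕁)).hom)) ≫ S.mulMap 𝕁 ≫ S.opUnit =
      (𝟙 A ⊚ₘ S.mulMap 𝕁) ≫ S.mulMap 𝕁 ≫ S.opUnit :=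
  @counit_mulMap_left C _ (revDuoidal C) A S.rev h

/-- The unit of the monad `A ⊚ -`. -/
def unitMap (X : C) : X ⟶ A ⊚ X := (cl X).inv ≫ (S.η ⊚ₘ 𝟙 X)

theorem circMonad_η (X : C) : S.circMonad.η.app X = S.unitMap X := by
  change (cl X).inv ≫ (circ (C := C)).whiskerRight S.η X = _
  rw [← @tensorHom_id C _ circ]
  rfl

theorem χ_eq (X Y : C) : S.χ X Y = S.unitMap (X ⊡ Y) ≫ S.opMul X Y := by
  have e : ((S.η ≫ S.Δ) ⊚ₘ 𝟙 (X ⊡ Y)) = (S.η ⊚ₘ 𝟙 (X ⊡ Y)) ≫ (S.Δ ⊚ₘ 𝟙 (X ⊡ Y)) := by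
    rw [circ_comp, Category.comp_id]
  simp only [χ, e, unitMap, opMul, Category.assoc]

/-- The weakly opmonoidal structure of the monad `A ⊚ -`. -/
def weakOpmonoidal (hWB : S.WB) (h₁ : S.RLU) (h₂ : S.LLU) (h₃ : S.RLC) (h₄ : S.RRC) :
    @WeakOpmonoidal C _ bul S.circMonad :=
  @WeakOpmonoidal.mk C _ bul S.circMonad S.opMul S.opUnit
    (fun f g => by
      rw [circMonad_map, circMonad_map, circMonad_map]
      exact S.opMul_natural f g)
    (fun X Y Z => by
      rw [circMonad_map]
      exact S.opMul_coassoc X Y Z)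
    (fun X => by
      rw [circMonad_map]
      exact S.opMul_counit_left X)
    (fun X => by
      rw [circMonad_map]
      exact S.opMul_counit_right X)
    (fun X Y => by
      have e := S.mul_opMul hWB X Y
      rw [← circMonad_map, ← circMonad_μ, ← circMonad_μ, ← circMonad_μ] at e
      exact e)
    (fun X Y Z => by
      have e := S.χ_opMul h₁ X Y Z
      rw [χ_eq, χ_eq, χ_eq, Category.assoc, Category.assoc, ← circMonad_η, ← circMonad_η,
        ← circMonad_η, ← circMonad_μ] at e
      exact e)
    (fun X Y Z => by
      have e := S.opMul_χ h₂ X Y Z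
      rw [χ_eq, χ_eq, χ_eq, Category.assoc, Category.assoc, ← circMonad_η, ← circMonad_η,
        ← circMonad_η, ← circMonad_μ] at e
      exact e)
    (by
      rw [circMonad_map, circMonad_map, circMonad_map, circMonad_μ]
      exact S.counit_mulMap_left h₄)
    (by
      rw [circMonad_map, circMonad_map, circMonad_map, circMonad_μ]
      exact S.counit_mulMap_right h₃)

/-- The monad `A ⊚ -` is a weak bimonad. -/
theorem exists_weakBimonad [IsIdempotentComplete C] (hWB : S.WB) (h₁ : S.RLU) (h₂ : S.LLU)
    (h₃ : S.RLC) (h₄ : S.RRC) :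
    ∃ W : @WeakBimonad C _ bul S.circMonad,
      (∀ X Y : C, @WeakBimonad.comul C _ bul _ W X Y = (S.Δ ⊚ₘ 𝟙 (X ⊡ Y)) ≫ ζ A A X Y) ∧
      @WeakBimonad.counit C _ bul _ W = (S.ε ⊚ₘ 𝟙 𝕁) ≫ ϖ :=
  @WeakOpmonoidal.exists_weakBimonad C _ bul _ _ (S.weakOpmonoidal hWB h₁ h₂ h₃ h₄)

end MonoidComonoid

/-! ### The opposite duoidal category, and the weak bicomonads -/

/-- The opposite of a duoidal category, with the two products interchanged; accordingly the middle
arguments of `ζ` are exchanged. -/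
abbrev opDuoidal (C : Type u) [Category.{v} C] [Duoidal C] : Duoidal Cᵒᵖ where
  circ := @monoidalCategoryOp C _ bul
  bul := @monoidalCategoryOp C _ circ
  δ := (ϖ (C := C)).op
  ϖ := (δ (C := C)).op
  τ := (τ (C := C)).op
  ζ X Y Z W := (ζ X.unop Z.unop Y.unop W.unop).op
  ζ_natural f g h k := congrArg Quiver.Hom.op (ζ_natural f.unop h.unop g.unop k.unop).symm
  ϖ_assoc := by
    have e : (δ : (𝕀 : C) ⟶ _) ≫ (δ ⊡ₘ 𝟙 𝕀) = (δ ≫ (𝟙 𝕀 ⊡ₘ δ)) ≫ (bα 𝕀 𝕀 𝕀).inv := by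
      rw [← δ_coassoc, Category.assoc, Category.assoc, Iso.hom_inv_id, Category.comp_id]
    exact congrArg Quiver.Hom.op e
  τ_ϖ := congrArg Quiver.Hom.op (δ_τ_left (C := C))
  ϖ_τ := congrArg Quiver.Hom.op (δ_τ_right (C := C))
  δ_coassoc := by
    have e : ((cα 𝕁 𝕁 (𝕁 : C)).inv ≫ (ϖ ⊚ₘ 𝟙 𝕁)) ≫ ϖ = (𝟙 𝕁 ⊚ₘ ϖ) ≫ ϖ := by
      rw [Category.assoc, ϖ_assoc, Iso.inv_hom_id_assoc]
    exact congrArg Quiver.Hom.op e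
  δ_τ_left := by
    exact congrArg Quiver.Hom.op (τ_ϖ (C := C))
  δ_τ_right := congrArg Quiver.Hom.op (ϖ_τ (C := C))
  ζ_circ_assoc X₁ Y₁ Z₁ W₁ U₁ V₁ := by
    have e (X Y Z W U V : C) :
        (((bα X Z U).inv ⊚ₘ (bα Y W V).inv) ≫ ζ (X ⊡ Z) U (Y ⊡ W) V) ≫
          (ζ X Z Y W ⊡ₘ 𝟙 (U ⊚ V)) =
        (ζ X (Z ⊡ U) Y (W ⊡ V) ≫ (𝟙 (X ⊚ Y) ⊡ₘ ζ Z U W V)) ≫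
          (bα (X ⊚ Y) (Z ⊚ W) (U ⊚ V)).inv := by
      have e' : ((bα X Z U).inv ⊚ₘ (bα Y W V).inv) ≫ ((bα X Z U).hom ⊚ₘ (bα Y W V).hom) =
          𝟙 _ := by
        rw [circ_comp, Iso.inv_hom_id, Iso.inv_hom_id, circ_id]
      rw [Category.assoc, ζ_bul_assoc', reassoc_of% e', Category.assoc]
    exact congrArg Quiver.Hom.op (e X₁.unop Y₁.unop Z₁.unop W₁.unop U₁.unop V₁.unop)
  ζ_bul_assoc X₁ Y₁ Z₁ W₁ U₁ V₁ := by
    have e (X Y Z W U V : C) :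
        ((cα (X ⊡ W) (Y ⊡ U) (Z ⊡ V)).inv ≫ (ζ X W Y U ⊚ₘ 𝟙 (Z ⊡ V))) ≫
          ζ (X ⊚ Y) (W ⊚ U) Z V =
        ((𝟙 (X ⊡ W) ⊚ₘ ζ Y U Z V) ≫ ζ X W (Y ⊚ Z) (U ⊚ V)) ≫
          ((cα X Y Z).inv ⊡ₘ (cα W U V).inv) := by
      rw [Category.assoc, ζ_circ_assoc', Iso.inv_hom_id_assoc, Category.assoc]
    exact congrArg Quiver.Hom.op (e X₁.unop Y₁.unop Z₁.unop W₁.unop U₁.unop V₁.unop)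
  ζ_δ_left X₁ Y₁ := by
    have e (X Y : C) := ζ_ϖ_left X Y
    simp only [← Category.assoc] at e
    exact congrArg Quiver.Hom.op (e X₁.unop Y₁.unop)
  ζ_δ_right X₁ Y₁ := by
    have e (X Y : C) := ζ_ϖ_right X Y
    simp only [← Category.assoc] at e
    exact congrArg Quiver.Hom.op (e X₁.unop Y₁.unop)
  ζ_ϖ_left X₁ Y₁ := by
    have e (X Y : C) := ζ_δ_left X Y
    simp only [← Category.assoc] at e
    exact congrArg Quiver.Hom.op (e X₁.unop Y₁.unop)
  ζ_ϖ_right X₁ Y₁ := by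
    have e (X Y : C) := ζ_δ_right X Y
    simp only [← Category.assoc] at e
    exact congrArg Quiver.Hom.op (e X₁.unop Y₁.unop)

namespace MonoidComonoid
variable {C : Type u} [Category.{v} C] [Duoidal C] {A : C} (S : MonoidComonoid A)

/-- The same structure in the opposite duoidal category: the comonoid structure is read as a monoid
structure, and the other way round. -/
def op : @MonoidComonoid Cᵒᵖ _ (opDuoidal C) (Opposite.op A) :=
  @MonoidComonoid.mk Cᵒᵖ _ (opDuoidal C) (Opposite.op A)
    (@MonObj.mk Cᵒᵖ _ (@monoidalCategoryOp C _ bul) (Opposite.op A) S.ε.op S.Δ.op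
      (congrArg Quiver.Hom.op (@ComonObj.counit_comul C _ bul A S.comon))
      (congrArg Quiver.Hom.op (@ComonObj.comul_counit C _ bul A S.comon))
      (by
        have e : S.Δ ≫ (bul (C := C)).whiskerRight S.Δ A =
            (S.Δ ≫ (bul (C := C)).whiskerLeft A S.Δ) ≫ (bα A A A).inv := by
          rw [← @tensorHom_id C _ bul, ← @id_tensorHom C _ bul, Category.assoc]
          exact S.Δ_coassoc_inv.symm
        exact congrArg Quiver.Hom.op e))
    (@ComonObj.mk Cᵒᵖ _ (@monoidalCategoryOp C _ circ) (Opposite.op A) S.η.op S.μ.op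
      (congrArg Quiver.Hom.op (@MonObj.one_mul C _ circ A S.mon))
      (congrArg Quiver.Hom.op (@MonObj.mul_one C _ circ A S.mon))
      (by
        have e : (circ (C := C)).whiskerLeft A S.μ ≫ S.μ =
            ((cα A A A).inv ≫ (circ (C := C)).whiskerRight S.μ A) ≫ S.μ := by
          have h := @MonObj.mul_assoc C _ circ A S.mon
          rw [Category.assoc]
          exact ((Iso.inv_comp_eq _).mpr h).symm
        exact congrArg Quiver.Hom.op e))

theorem WB.op (h : S.WB) : @MonoidComonoid.WB Cᵒᵖ _ (opDuoidal C) _ S.op := by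
  have e : S.μ ≫ S.Δ = ((S.Δ ⊚ₘ S.Δ) ≫ ζ A A A A) ≫ (S.μ ⊡ₘ S.μ) := by
    rw [Category.assoc]; exact h
  exact congrArg Quiver.Hom.op e

/-- In the opposite duoidal category the conditions on the counit become conditions on the unit, and
the other way round. -/
theorem LRC.op (h : S.LRC) : @MonoidComonoid.RLU Cᵒᵖ _ (opDuoidal C) _ S.op := by
  have e₁ : S.counitLeft = ((cα (𝕁 ⊚ A) A A).hom ≫ (cα 𝕁 A (A ⊚ A)).hom) ≫
      (((𝟙 𝕁 ⊚ₘ (𝟙 A ⊚ₘ S.μ)) ≫ (𝟙 𝕁 ⊚ₘ S.μ)) ≫ (𝟙 𝕁 ⊚ₘ S.ε)) ≫ ϖ := by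
    have e := cα_naturality (𝟙 (𝕁 : C)) (𝟙 A) S.μ
    rw [circ_id] at e
    simp only [counitLeft, Category.assoc, reassoc_of% e]
  have e₂ : ((𝟙 (𝕁 ⊚ A) ⊚ₘ S.Δ) ⊚ₘ 𝟙 A) ≫ (((br (𝕁 ⊚ A)).inv ⊚ₘ 𝟙 (A ⊡ A)) ⊚ₘ 𝟙 A) =
      (((br (𝕁 ⊚ A)).inv ⊚ₘ S.Δ) ⊚ₘ 𝟙 A) := by
    simp only [circ_comp, Category.comp_id, Category.id_comp]
  -- Passing to the opposite category turns composites bracketed to the left into composites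
  -- bracketed to the right, as they occur in `RLU`.
  have e₃ := h
  rw [LRC, reassoc_of% e₂] at e₃
  simp only [← Category.assoc] at e₃
  exact congrArg Quiver.Hom.op (e₁.symm.trans e₃)

theorem RRC.op (h : S.RRC) : @MonoidComonoid.LLU Cᵒᵖ _ (opDuoidal C) _ S.op := by
  have e₁ : S.counitRight = ((cα A A (A ⊚ 𝕁)).inv ≫ (cα (A ⊚ A) A 𝕁).inv) ≫
      ((((S.μ ⊚ₘ 𝟙 A) ⊚ₘ 𝟙 𝕁) ≫ (S.μ ⊚ₘ 𝟙 𝕁)) ≫ (S.ε ⊚ₘ 𝟙 𝕁)) ≫ ϖ := by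
    have e := cα_inv_naturality S.μ (𝟙 A) (𝟙 (𝕁 : C))
    rw [circ_id] at e
    simp only [counitRight, Category.assoc, reassoc_of% e]
  have e₂ : (𝟙 A ⊚ₘ (S.Δ ⊚ₘ 𝟙 (A ⊚ 𝕁))) ≫ (𝟙 A ⊚ₘ (𝟙 (A ⊡ A) ⊚ₘ (br (A ⊚ 𝕁)).inv)) =
      (𝟙 A ⊚ₘ (S.Δ ⊚ₘ (br (A ⊚ 𝕁)).inv)) := by
    simp only [circ_comp, Category.comp_id, Category.id_comp]
  have e₃ := h
  rw [RRC, reassoc_of% e₂] at e₃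
  simp only [← Category.assoc] at e₃
  exact congrArg Quiver.Hom.op (e₁.symm.trans e₃)

theorem unitLeft_assoc :
    S.unitLeft ≫ (bα (A ⊡ A) A 𝕀).hom ≫ (bα A A (A ⊡ 𝕀)).hom =
      ((((δ ≫ (S.η ⊡ₘ 𝟙 𝕀)) ≫ (S.Δ ⊡ₘ 𝟙 𝕀)) ≫ (bα A A 𝕀).hom) ≫ (S.Δ ⊡ₘ 𝟙 (A ⊡ 𝕀))) ≫
        (bα A A (A ⊡ 𝕀)).hom := by
  have e := bα_naturality S.Δ (𝟙 A) (𝟙 (𝕀 : C))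
  rw [bul_id] at e
  simp only [unitLeft, Category.assoc, reassoc_of% e]

theorem LLU.op (h : S.LLU) : @MonoidComonoid.RRC Cᵒᵖ _ (opDuoidal C) _ S.op := by
  have e₂ : (𝟙 A ⊡ₘ (S.μ ⊡ₘ (cr (A ⊡ 𝕀)).hom)) =
      (𝟙 A ⊡ₘ (𝟙 (A ⊚ A) ⊡ₘ (cr (A ⊡ 𝕀)).hom)) ≫ (𝟙 A ⊡ₘ (S.μ ⊡ₘ 𝟙 (A ⊡ 𝕀))) := by
    simp only [bul_comp, Category.comp_id, Category.id_comp]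
  have e₃ := h
  rw [LLU, unitLeft_assoc, e₂] at e₃
  simp only [← Category.assoc] at e₃
  exact congrArg Quiver.Hom.op e₃

theorem LRU.op (h : S.LRU) : @MonoidComonoid.RLC Cᵒᵖ _ (opDuoidal C) _ S.op := by
  have e₂ : (𝟙 A ⊡ₘ (S.μ ⊡ₘ (cl (A ⊡ 𝕀)).hom)) =
      (𝟙 A ⊡ₘ (𝟙 (A ⊚ A) ⊡ₘ (cl (A ⊡ 𝕀)).hom)) ≫ (𝟙 A ⊡ₘ (S.μ ⊡ₘ 𝟙 (A ⊡ 𝕀))) := by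
    simp only [bul_comp, Category.comp_id, Category.id_comp]
  have e₃ := h
  rw [LRU, unitLeft_assoc, e₂] at e₃
  simp only [← Category.assoc] at e₃
  exact congrArg Quiver.Hom.op e₃

/-- The comonad `A ⊡ -` on `C` is the monad `A ⊚ -` of the opposite duoidal category, where `⊚` and
`⊡` are interchanged. -/
theorem exists_weakBicomonad_left [IsIdempotentComplete C] (hWB : S.WB) (h₁ : S.LRC) (h₂ : S.RRC)
    (h₃ : S.LRU) (h₄ : S.LLU) :
    ∃ W : @WeakBicomonad C _ circ S.bulLeftComonad,
      (∀ X Y : C, @WeakBicomonad.mul C _ circ _ W X Y = ζ A X A Y ≫ (S.μ ⊡ₘ 𝟙 (X ⊚ Y))) ∧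
      @WeakBicomonad.unit C _ circ _ W = δ ≫ (S.η ⊡ₘ 𝟙 𝕀) := by
  obtain ⟨W, hW, hW'⟩ := @exists_weakBimonad Cᵒᵖ _ (opDuoidal C) _ S.op
    inferInstance hWB.op h₁.op h₂.op h₃.op h₄.op
  exact ⟨W, fun X Y => congrArg Quiver.Hom.unop (hW (Opposite.op X) (Opposite.op Y)),
    congrArg Quiver.Hom.unop hW'⟩

/-- The comonad `- ⊡ A` is the comonad `A ⊡ -` of the reversed duoidal category. -/
theorem exists_weakBicomonad_right [IsIdempotentComplete C] (hWB : S.WB) (h₁ : S.LLC) (h₂ : S.RLC)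
    (h₃ : S.RRU) (h₄ : S.RLU) :
    ∃ W : @WeakBicomonad C _ circ S.bulRightComonad,
      (∀ X Y : C, @WeakBicomonad.mul C _ circ _ W X Y = ζ X A Y A ≫ (𝟙 (X ⊚ Y) ⊡ₘ S.μ)) ∧
      @WeakBicomonad.unit C _ circ _ W = δ ≫ (𝟙 𝕀 ⊡ₘ S.η) :=
  @exists_weakBicomonad_left C _ (revDuoidal C) A S.rev _ hWB h₁ h₂ h₃ h₄

end MonoidComonoid

theorem mainTheorem3 {C : Type u} [Category.{v} C] [Duoidal C] [IsIdempotentComplete C]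
    (A : C) (S : MonoidComonoid A) (hWB : S.WB) :
    (S.RLU → S.LLU → S.RLC → S.RRC →
      ∃ W : @WeakBimonad C _ TwoMonoidal.bul S.circMonad,
        (∀ X Y : C, @WeakBimonad.comul C _ TwoMonoidal.bul _ W X Y =
          (S.Δ ⊚ₘ 𝟙 (X ⊡ Y)) ≫ Duoidal.ζ A A X Y) ∧
        @WeakBimonad.counit C _ TwoMonoidal.bul _ W = (S.ε ⊚ₘ 𝟙 𝕁) ≫ Duoidal.ϖ) ∧
    (S.LLC → S.RLC → S.RRU → S.RLU →
      ∃ W : @WeakBicomonad C _ TwoMonoidal.circ S.bulRightComonad,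
        (∀ X Y : C, @WeakBicomonad.mul C _ TwoMonoidal.circ _ W X Y =
          Duoidal.ζ X A Y A ≫ (𝟙 (X ⊚ Y) ⊡ₘ S.μ)) ∧
        @WeakBicomonad.unit C _ TwoMonoidal.circ _ W = Duoidal.δ ≫ (𝟙 𝕀 ⊡ₘ S.η)) ∧
    (S.LRC → S.RRC → S.LRU → S.LLU →
      ∃ W : @WeakBicomonad C _ TwoMonoidal.circ S.bulLeftComonad,
        (∀ X Y : C, @WeakBicomonad.mul C _ TwoMonoidal.circ _ W X Y =
          Duoidal.ζ A X A Y ≫ (S.μ ⊡ₘ 𝟙 (X ⊚ Y))) ∧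
        @WeakBicomonad.unit C _ TwoMonoidal.circ _ W = Duoidal.δ ≫ (S.η ⊡ₘ 𝟙 𝕀)) := by
  exact ⟨S.exists_weakBimonad hWB, S.exists_weakBicomonad_right hWB,
    S.exists_weakBicomonad_left hWB⟩
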